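/- Let $n\ge 0$ be an integer. Partitions $\lambda=(\lambda_1\ge\dots\ge\lambda_n\ge 0)$ are padded with zeros, and $|\lambda|=\sum_i\lambda_i$. For $\sigma>0$ let $C^{(\sigma)}_\lambda(\vec x)$, $\vec x=(x_1,\dots,x_n)$, be the Jack polynomials: the unique family of symmetric polynomials such that $C^{(\sigma)}_\lambda$ is homogeneous of degree $|\lambda|$, is an eigenfunction of $$\mathrm D_2=\sum_{i} x_i^2\frac{\partial^2}{\partial x_i^2}+\frac2\sigma\sum_{i\ne j}\frac{x_i^2}{x_i-x_j}\frac{\partial}{\partial x_i}$$ with eigenvalue $\sum_{i}\lambda_i\bigl(\lambda_i-1-\tfrac2\sigma(i-1)\bigr)+\tfrac2\sigma|\lambda|(n-1)$, contains only monomial symmetric functions $m_\mu$ with $\mu\le\lambda$ in dominance order, and satisfies $\sum_{|\lambda|=k}C^{(\sigma)}_\lambda(\vec x)=(x_1+\dots+x_n)^k$ for all $k\ge0$. Put $[c]^{(\sigma)}_\lambda=\prod_{i=1}^n\bigl(c-\tfrac{i-1}\sigma\bigr)_{\lambda_i}$ with $(a)_m=a(a+1)\cdots(a+m-1)$, and $${}_0F_1^{(\sigma)}(;c;\vec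 x)=\sum_\lambda\frac{C^{(\sigma)}_\lambda(\vec x)}{[c]^{(\sigma)}_\lambda\,|\lambda|!}.$$ Let $\Delta(\vec x)=\prod_{1\le i<j\le n}(x_j-x_i)$ and let $I_\nu(z)=\sum_{k\ge0}\frac{(z/2)^{\nu+2k}}{k!\,\Gamma(\nu+k+1)}$ be the modified Bessel function of the first kind (with $1/\Gamma=0$ at the poles of $\Gamma$). All complex powers and square roots are principal branches. Let $c\in\mathbb C$ be such that none of $c,c-1,\dots,c-(n-1)$ belongs to $\{0,-1,-2,\dots\}$. Then the series for ${}_0F_1^{(1)}(;c;\vec x)$ converges absolutely for every $\vec x\in\mathbb C^n$, and its sum is a continuous function of $\vec x\in\mathbb C^n$. For every $\vec x\in\mathbb C^n$ with pairwise distinct non-zero coordinates, $${}_0F_1^{(1)}(;c;\vec x)=(-1)^{\lfloor n/2\rfloor}\,\frac{\prod_{i=1}^n\Gamma(c+1-i)\,x_i^{\,n-c/2}}{\Delta(\vec x)}\,\det\Bigl(x_j^{-i/2}\,I_{c+i-2n}(2\sqrt{x_j})\Bigr)_{i,j=1}^n ,$$ and for every $x\in\mathbb C\setminus\{0\}$,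 with $\vec 1^n=(1,\dots,1)$, $${}_0F_1^{(1)}(;c;x\vec 1^n)=x^{n(n-c)/2}\,\frac{\prod_{i=1}^n\Gamma(c+1-i)}{\prod_{j=1}^{n-1}j!}\,\det\Bigl(I_{c-n+j-i}(2\sqrt{x})\Bigr)_{i,j=1}^n .$$ By continuity, the two identities hold at the remaining points (coinciding or vanishing coordinates, respectively $x=0$) in the sense of limits. -/

import Mathlib

open scoped Nat

/-- Integer partitions `l₁ ≥ l₂ ≥ ⋯ ≥ lₙ ≥ 0` with at most `n` non-zero parts, padded by zeros
(the part `l_i` of the literature is `l.1 (i - 1)`). -/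
abbrev IntPartition (n : ℕ) : Type := {l : Fin n → ℕ // Antitone l}

namespace IntPartition

/-- The size `|l| = l₁ + ⋯ + lₙ`. -/
def size {n : ℕ} (l : IntPartition n) : ℕ := ∑ i, l.1 i

/-- The finite set of the partitions of size `k` with at most `n` parts. -/
noncomputable def ofSize (n k : ℕ) : Finset (IntPartition n) := by
  classical
  exact (Finset.piAntidiag (Finset.univ : Finset (Fin n)) k).subtype (fun l => Antitone l)

/-- Membership in `ofSize` is what its name says. -/
theorem mem_ofSize {n k : ℕ} (l : IntPartition n) : l ∈ ofSize n k ↔ l.size = k := by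
  classical
  simp [ofSize, size, Finset.mem_subtype, Finset.mem_piAntidiag]

/-- The dominance order `m ≤ l` of partitions of the same size:
`m₁ + ⋯ + m_r ≤ l₁ + ⋯ + l_r` for all `r`. -/
def Dominates {n : ℕ} (l m : IntPartition n) : Prop :=
  m.size = l.size ∧ ∀ r : Fin n, ∑ i ∈ Finset.Iic r, m.1 i ≤ ∑ i ∈ Finset.Iic r, l.1 i

end IntPartition

/-- The operator
`D_k = ∑ i, x_i ^ k ∂_i² + (2 / σ) ∑_{i ≠ j} x_i ^ k / (x_i - x_j) ∂_i`,
applied to a polynomial `f` and evaluated at a point `x` with distinct coordinates. -/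
noncomputable def jackD {n : ℕ} (σ : ℝ) (k : ℕ) (f : MvPolynomial (Fin n) ℂ)
    (x : Fin n → ℂ) : ℂ :=
  ∑ i, x i ^ k * MvPolynomial.eval x (MvPolynomial.pderiv i (MvPolynomial.pderiv i f)) +
    2 / (σ : ℂ) * ∑ i, ∑ j ∈ Finset.univ.erase i,
      x i ^ k / (x i - x j) * MvPolynomial.eval x (MvPolynomial.pderiv i f)

/-- `ρ_l = ∑_{i=1}^n l_i (l_i - 1 - (2 / σ) (i - 1))`. -/
noncomputable def jackRho {n : ℕ} (σ : ℝ) (l : IntPartition n) : ℂ :=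
  ∑ i : Fin n, (l.1 i : ℂ) * ((l.1 i : ℂ) - 1 - 2 / (σ : ℂ) * ((i : ℕ) : ℂ))

/-- The defining properties of the family of Jack polynomials `C_l^{(σ)}(x₁, …, xₙ)`.
They determine the family uniquely for `σ > 0`. -/
structure IsJackFamily {n : ℕ} (σ : ℝ) (C : IntPartition n → MvPolynomial (Fin n) ℂ) :
    Prop where
  /-- `C_l` is a symmetric polynomial. -/
  symm : ∀ l, (C l).IsSymmetric
  /-- `C_l` is homogeneous of degree `|l|`. -/
  homog : ∀ l, (C l).IsHomogeneous l.size
  /-- `C_l` is an eigenfunction of `D₂` with eigenvalue `ρ_l + (2 / σ) |l| (n - 1)`. -/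
  eigen : ∀ l, ∀ x : Fin n → ℂ, Function.Injective x →
    jackD σ 2 (C l) x =
      (jackRho σ l + 2 / (σ : ℂ) * (l.size : ℂ) * ((n : ℂ) - 1)) * MvPolynomial.eval x (C l)
  /-- Only monomial symmetric functions `m_μ` with `μ ≤ l` in the dominance order occur in `C_l`.
  The coefficient of `m_μ` in a symmetric polynomial is that of the monomial
  `x₁ ^ μ₁ ⋯ xₙ ^ μₙ`. -/
  triangular : ∀ l μ : IntPartition n,
    (C l).coeff (Finsupp.equivFunOnFinite.symm μ.1) ≠ 0 → l.Dominates μ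
  /-- The normalisation `∑_{|l| = k} C_l = (x₁ + ⋯ + xₙ) ^ k`. -/
  normalized : ∀ k : ℕ,
    ∑ l ∈ IntPartition.ofSize n k, C l = (∑ i, MvPolynomial.X i) ^ k

open Classical in
/-- The Jack polynomials `C_l^{(σ)}` in `n` variables. -/
noncomputable def jackC {n : ℕ} (σ : ℝ) : IntPartition n → MvPolynomial (Fin n) ℂ :=
  if h : ∃ C : IntPartition n → MvPolynomial (Fin n) ℂ, IsJackFamily σ C then h.choose else 0

/-- The generalised Pochhammer symbol `[a]_l^{(σ)} = ∏_{i=1}^n (a - (i - 1) / σ)_{l_i}`. -/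
noncomputable def genPochhammer {n : ℕ} (σ : ℝ) (l : IntPartition n) (a : ℂ) : ℂ :=
  ∏ i : Fin n, (ascPochhammer ℂ (l.1 i)).eval (a - ((i : ℕ) : ℂ) / (σ : ℂ))

/-- The term with index `l` of the series of `pFq^{(σ)}(a₁, …, a_p; b₁, …, b_q; x)`. -/
noncomputable def mvHypTerm {n : ℕ} (σ : ℝ) (a b : List ℂ) (x : Fin n → ℂ)
    (l : IntPartition n) : ℂ :=
  (a.map (genPochhammer σ l)).prod / ((b.map (genPochhammer σ l)).prod * ((l.size)! : ℂ)) *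
    MvPolynomial.eval x (jackC σ l)

/-- The multivariate hypergeometric function `pFq^{(σ)}(a₁, …, a_p; b₁, …, b_q; x)`. -/
noncomputable def mvHyp {n : ℕ} (σ : ℝ) (a b : List ℂ) (x : Fin n → ℂ) : ℂ :=
  ∑' l : IntPartition n, mvHypTerm σ a b x l

/-- The Vandermonde product `Δ(x) = ∏_{i < j} (x_j - x_i)`. -/
noncomputable def vandermondeProd {n : ℕ} (x : Fin n → ℂ) : ℂ :=
  ∏ i : Fin n, ∏ j ∈ Finset.Ioi i, (x j - x i)

/-- The modified Bessel function of the first kind (principal branch)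
`I_ν(z) = (z / 2) ^ ν ∑ k, (z / 2) ^ (2 k) / (k! Γ(ν + k + 1))`, for `z ≠ 0`.
At the poles of `Γ` Mathlib has `Complex.Gamma = 0`, so that the terms with
`1 / Γ(ν + k + 1) = 0` vanish, as they should. -/
noncomputable def besselI (ν z : ℂ) : ℂ :=
  (z / 2) ^ ν * ∑' k : ℕ, (z / 2) ^ (2 * k) / ((k ! : ℂ) * Complex.Gamma (ν + (k : ℂ) + 1))

/-! For σ = 1 the Jack polynomials are multiples of Schur polynomials, and both determinants then
come from the Cauchy–Binet formula. Write δ for `staircase n`, e = l + δ, and a_e for the alternant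
det(x_j ^ e_i); the Schur polynomial is s_l = a_e / a_δ.

Identification. Multiplication by a_δ conjugates D₂, up to an additive constant, to ∑ x_i² ∂_i²,
which is diagonal on monomials. For any Jack family, a_δ C_l is therefore an alternating polynomial
whose exponents have a prescribed sum and sum of squares and are dominated by e. This leaves only
multiples of a_e (`IsJackFamily.exists_smul_alternant`). The normalisation fixes the factor
(`IsJackFamily.alternant_staircase_mul`), and `schurCoeff_eq` evaluates it as |l|! a_δ(e) / ∏ e_i!.
Conversely, the Schur multiples do form a Jack family (`isJackFamily_schur`).

Summation. The factor |l|! cancels, and the Pochhammer symbol also splits over the entries of e, so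
that a term of the series is a constant times a_δ(e) ∏ β(e_i) s_l(x), where β(m) = 1 / (m! Γ(c - n +
m + 1)). The product a_δ(e) ∏ β(e_i) is again a determinant, because multiplying β by a falling
factorial lowers its Bessel index. Since a_δ(x) s_l(x) = det(x_j ^ e_i), Cauchy–Binet
(`tsum_det_mul_det`) sums the series to a determinant of Bessel series. At x(1,…,1) the value of s_l
is a multiple of x ^ |l| a_δ(e), by a q → 1 specialisation (`eval_const_schurQuotient`), and a_δ(e)
is a determinant of falling factorials; Cauchy–Binet applies again.

Convergence and continuity follow from a summable bound on polydiscs, which rests on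
`norm_eval_schurQuotient_le`. -/

namespace MvPolynomial

/-! ### Alternants and divisibility by the Vandermonde product -/

/-- The exponent of a monomial in `n` variables given by a function. -/
noncomputable abbrev expo {n : ℕ} (f : Fin n → ℕ) : Fin n →₀ ℕ := Finsupp.equivFunOnFinite.symm f

/-- Replacing `X i` by `X j` changes nothing modulo the ideal generated by `X i - X j`. -/
theorem X_sub_X_dvd_iff {σ R : Type*} [DecidableEq σ] [CommRing R] (i j : σ)
    (p : MvPolynomial σ R) :
    X i - X j ∣ p ↔ aeval (Function.update (X : σ → MvPolynomial σ R) i (X j)) p = 0 := by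
  constructor
  · rintro ⟨q, rfl⟩
    rw [map_mul, map_sub, aeval_X, aeval_X]
    by_cases h : j = i
    · subst h; simp
    · simp [h]
  · intro h
    rw [← Ideal.mem_span_singleton, ← Ideal.Quotient.eq_zero_iff_mem]
    have key : (Ideal.Quotient.mkₐ R (Ideal.span {(X i - X j : MvPolynomial σ R)})).comp
        (aeval (Function.update (X : σ → MvPolynomial σ R) i (X j))) =
        Ideal.Quotient.mkₐ R (Ideal.span {(X i - X j : MvPolynomial σ R)}) := by
      apply MvPolynomial.algHom_ext
      intro k
      by_cases hk : k = i
      · subst hk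
        simp only [AlgHom.comp_apply, aeval_X, Function.update_self, Ideal.Quotient.mkₐ_eq_mk]
        rw [eq_comm, Ideal.Quotient.eq]
        exact Ideal.mem_span_singleton_self _
      · simp [hk]
    have := DFunLike.congr_fun key p
    rw [AlgHom.comp_apply, h, map_zero] at this
    exact this.symm

theorem prime_X_sub_X {σ R : Type*} [DecidableEq σ] [CommRing R] [IsDomain R] {i j : σ}
    (hij : i ≠ j) : Prime (X i - X j : MvPolynomial σ R) := by
  refine ⟨sub_ne_zero.2 fun h => hij (X_injective h), fun h => ?_, fun p q h => ?_⟩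
  · have := (X_sub_X_dvd_iff i j (1 : MvPolynomial σ R)).1 h.dvd
    simp at this
  · simp only [X_sub_X_dvd_iff, map_mul, mul_eq_zero] at h ⊢
    exact h

/-- The alternant `det (x_j ^ e_i)`. -/
noncomputable def alternant {n : ℕ} (e : Fin n → ℕ) : MvPolynomial (Fin n) ℂ :=
  Matrix.det (Matrix.of fun i j : Fin n => (X j : MvPolynomial (Fin n) ℂ) ^ e i)

theorem eval_alternant {n : ℕ} (e : Fin n → ℕ) (x : Fin n → ℂ) :
    eval x (alternant e) = Matrix.det (Matrix.of fun i j : Fin n => x j ^ e i) := by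
  rw [alternant, RingHom.map_det]
  congr 1
  ext i j
  simp

theorem rename_alternant {n : ℕ} (e : Fin n → ℕ) (π : Equiv.Perm (Fin n)) :
    rename π (alternant e) = (Equiv.Perm.sign π : ℤ) • alternant e := by
  have h : rename π (alternant e) = Matrix.det ((Matrix.of fun i j : Fin n =>
      (X j : MvPolynomial (Fin n) ℂ) ^ e i).submatrix id π) := by
    rw [alternant, AlgHom.map_det]
    congr 1
    ext i j
    simp
  rw [h, Matrix.det_permute', alternant, zsmul_eq_mul]

theorem monomial_expo_eq_prod {n : ℕ} (f : Fin n → ℕ) :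
    (monomial (expo f) 1 : MvPolynomial (Fin n) ℂ) = ∏ i, X i ^ f i := by
  rw [monomial_eq, Finsupp.prod_fintype _ _ (by simp)]
  simp

theorem alternant_eq_sum {n : ℕ} (e : Fin n → ℕ) :
    alternant e = ∑ π : Equiv.Perm (Fin n),
      monomial (expo (e ∘ π)) (((Equiv.Perm.sign π : ℤ) : ℂ)) := by
  rw [alternant, Matrix.det_apply]
  refine Finset.sum_congr rfl fun π _ => ?_
  have := monomial_expo_eq_prod (e ∘ π)
  simp only [Matrix.of_apply]
  simp only [Function.comp_apply] at this
  rw [← this, Units.smul_def, zsmul_eq_mul, ← mul_one (((Equiv.Perm.sign π : ℤ) : ℂ)),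
    ← C_mul_monomial]
  simp [Function.comp_def]

theorem coeff_alternant {n : ℕ} (e m : Fin n → ℕ) :
    coeff (expo m) (alternant e) = ∑ π : Equiv.Perm (Fin n),
      if e ∘ π = m then ((Equiv.Perm.sign π : ℤ) : ℂ) else 0 := by
  simp [alternant_eq_sum, coeff_sum, coeff_monomial, Finsupp.equivFunOnFinite.symm.injective.eq_iff]

theorem exists_of_coeff_alternant_ne_zero {n : ℕ} {e : Fin n → ℕ} {m : Fin n →₀ ℕ}
    (h : coeff m (alternant e) ≠ 0) : ∃ π : Equiv.Perm (Fin n), e ∘ π = m := by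
  by_contra! H
  apply h
  have : m = expo m := by ext; simp
  rw [this, coeff_alternant]
  exact Finset.sum_eq_zero fun π _ => if_neg (H π)

theorem strictAnti_comp_perm {n : ℕ} {e m : Fin n → ℕ} (he : StrictAnti e) (hm : StrictAnti m)
    (π : Equiv.Perm (Fin n)) (h : e ∘ π = m) : π = 1 := by
  have hmono : StrictMono π := by
    intro i j hij
    have h1 : m j < m i := hm hij
    rw [← h] at h1
    exact he.lt_iff_gt.1 h1
  exact (Equiv.Perm.monotone_iff π).1 hmono.monotone

theorem coeff_alternant_of_strictAnti {n : ℕ} {e m : Fin n → ℕ} (he : StrictAnti e)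
    (hm : StrictAnti m) : coeff (expo m) (alternant e) = if e = m then 1 else 0 := by
  rw [coeff_alternant, Finset.sum_eq_single 1]
  · simp [Equiv.Perm.coe_one]
  · intro π _ hπ
    exact if_neg fun h => hπ (strictAnti_comp_perm he hm π h)
  · simp

theorem isHomogeneous_alternant {n : ℕ} (e : Fin n → ℕ) :
    (alternant e).IsHomogeneous (∑ i, e i) := by
  intro m hm
  obtain ⟨π, hπ⟩ := exists_of_coeff_alternant_ne_zero hm
  have := Equiv.sum_comp π e
  rw [Finsupp.weight_apply, Finsupp.sum_fintype _ _ (by simp)]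
  simp [← this, ← hπ]

/-- The exponents `n - 1, n - 2, …, 0`. -/
def staircase (n : ℕ) (i : Fin n) : ℕ := (i.rev : ℕ)

theorem strictAnti_staircase (n : ℕ) : StrictAnti (staircase n) := by
  intro i j h
  exact Fin.rev_lt_rev.2 h

theorem alternant_staircase (n : ℕ) : alternant (staircase n) =
    ∏ i : Fin n, ∏ j ∈ Finset.Ioi i, (X i - X j : MvPolynomial (Fin n) ℂ) := by
  have h := Matrix.det_projVandermonde (fun _ => (1 : MvPolynomial (Fin n) ℂ)) X
  simp only [one_mul] at h
  rw [← h, alternant, ← Matrix.det_transpose]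
  congr 1
  ext i j
  simp [Matrix.projVandermonde_apply, staircase]

theorem alternant_staircase_ne_zero (n : ℕ) : alternant (staircase n) ≠ 0 := by
  rw [alternant_staircase]
  refine Finset.prod_ne_zero_iff.2 fun i _ => Finset.prod_ne_zero_iff.2 fun j hj => ?_
  exact (prime_X_sub_X (Finset.mem_Ioi.1 hj).ne).ne_zero

/-- Setting two variables equal makes two columns agree, so each difference divides the alternant;
the differences are pairwise coprime primes, hence so does their product. -/
theorem alternant_staircase_dvd {n : ℕ} (e : Fin n → ℕ) :
    alternant (staircase n) ∣ alternant e := by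
  rw [alternant_staircase, Finset.prod_sigma']
  refine Finset.prod_dvd_of_isRelPrime ?_ ?_
  · rintro ⟨i, j⟩ hij ⟨k, l⟩ hkl hne
    simp only [Finset.coe_sigma, Set.mem_sigma_iff, Finset.mem_coe, Finset.mem_univ,
      Finset.mem_Ioi, true_and] at hij hkl
    refine ((prime_X_sub_X hij.ne).irreducible.isRelPrime_iff_not_dvd).2 fun h => hne ?_
    simp only [X_sub_X_dvd_iff, map_sub, aeval_X, sub_eq_zero] at h
    rcases eq_or_ne k i with rfl | hk
    · rw [Function.update_self, Function.update_of_ne hkl.ne', X_inj] at h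
      rw [h]
    · rw [Function.update_of_ne hk] at h
      rcases eq_or_ne l i with rfl | hl
      · rw [Function.update_self, X_inj] at h
        exact absurd (h ▸ hij : l < k) hkl.not_gt
      · rw [Function.update_of_ne hl, X_inj] at h
        exact absurd h hkl.ne
  · rintro ⟨i, j⟩ hij
    have hij : i < j := by simpa using hij
    rw [X_sub_X_dvd_iff, alternant, AlgHom.map_det]
    refine Matrix.det_zero_of_column_eq hij.ne fun k => ?_
    simp [hij.ne']

/-! ### Schur polynomials: symmetry, homogeneity, triangularity -/

/-- The quotient of the alternant with exponents `e` by the Vandermonde product. -/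
noncomputable def schurQuotient {n : ℕ} (e : Fin n → ℕ) : MvPolynomial (Fin n) ℂ :=
  (alternant_staircase_dvd e).choose

theorem alternant_staircase_mul_schurQuotient {n : ℕ} (e : Fin n → ℕ) :
    alternant (staircase n) * schurQuotient e = alternant e :=
  (alternant_staircase_dvd e).choose_spec.symm

theorem isSymmetric_schurQuotient {n : ℕ} (e : Fin n → ℕ) : (schurQuotient e).IsSymmetric := by
  intro π
  have h := congrArg (rename π) (alternant_staircase_mul_schurQuotient e)
  rw [map_mul, rename_alternant, rename_alternant, smul_mul_assoc] at h
  apply mul_left_cancel₀ (alternant_staircase_ne_zero n)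
  rw [alternant_staircase_mul_schurQuotient]
  rcases Int.units_eq_one_or (Equiv.Perm.sign π) with hs | hs
  · simpa [hs] using h
  · simpa [hs] using h

/-- Grading by the weights `w`: the substitution `x_i ↦ T ^ w_i x_i`. -/
noncomputable def gradeHom {n : ℕ} (w : Fin n → ℕ) :
    MvPolynomial (Fin n) ℂ →ₐ[ℂ] Polynomial (MvPolynomial (Fin n) ℂ) :=
  aeval fun i => Polynomial.monomial (w i) (X i)

theorem gradeHom_monomial {n : ℕ} (w : Fin n → ℕ) (m : Fin n →₀ ℕ) (a : ℂ) :
    gradeHom w (monomial m a) = Polynomial.monomial (∑ i, w i * m i) (monomial m a) := by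
  rw [gradeHom, aeval_monomial, Finsupp.prod_fintype _ _ (by simp)]
  simp only [Polynomial.monomial_pow]
  have h : ∀ s : Finset (Fin n), ∏ i ∈ s, Polynomial.monomial (w i * m i)
      ((X i : MvPolynomial (Fin n) ℂ) ^ m i) =
      Polynomial.monomial (∑ i ∈ s, w i * m i) (∏ i ∈ s, X i ^ m i) := by
    intro s
    induction s using Finset.induction_on with
    | empty => simp
    | insert a s ha ih =>
      rw [Finset.prod_insert ha, ih, Polynomial.monomial_mul_monomial, Finset.sum_insert ha,
        Finset.prod_insert ha]
  rw [h, monomial_eq, Finsupp.prod_fintype _ _ (by simp), IsScalarTower.algebraMap_apply ℂ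
    (MvPolynomial (Fin n) ℂ), Polynomial.algebraMap_apply, Algebra.algebraMap_self,
    RingHom.id_apply, Polynomial.C_mul_monomial]
  rfl

theorem coeff_coeff_gradeHom {n : ℕ} (w : Fin n → ℕ) (p : MvPolynomial (Fin n) ℂ) (k : ℕ)
    (m : Fin n →₀ ℕ) :
    coeff m ((gradeHom w p).coeff k) = if ∑ i, w i * m i = k then coeff m p else 0 := by
  induction p using MvPolynomial.induction_on' with
  | monomial u a =>
    rw [gradeHom_monomial, Polynomial.coeff_monomial]
    rcases eq_or_ne u m with rfl | h
    · split_ifs <;> simp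
    · split_ifs <;> simp [coeff_monomial, h]
  | add p q hp hq =>
    rw [map_add, Polynomial.coeff_add, coeff_add, hp, hq]
    split_ifs <;> simp

theorem gradeHom_of_isHomogeneous {n d : ℕ} {p : MvPolynomial (Fin n) ℂ} (hp : p.IsHomogeneous d) :
    gradeHom (fun _ => 1) p = Polynomial.monomial d p := by
  ext k m
  rw [coeff_coeff_gradeHom, Polynomial.coeff_monomial]
  have h2 : ∑ i, 1 * m i = m.degree := by
    simp [Finsupp.degree_eq_sum]
  by_cases hm : coeff m p = 0
  · split_ifs <;> simp [hm]
  · have h1 : m.degree = d := by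
      by_contra h
      exact hm (hp.coeff_eq_zero h)
    rw [h2, h1]
    split_ifs <;> simp

/-- The grading map sends a homogeneous polynomial to a single power of T times itself, and that
factor can be cancelled in a domain. -/
theorem IsHomogeneous.of_mul_left {n d k : ℕ} {p q : MvPolynomial (Fin n) ℂ}
    (hp : p.IsHomogeneous d) (hp0 : p ≠ 0) (h : (p * q).IsHomogeneous (d + k)) :
    q.IsHomogeneous k := by
  have h1 := gradeHom_of_isHomogeneous h
  rw [map_mul, gradeHom_of_isHomogeneous hp, ← Polynomial.monomial_mul_monomial] at h1
  have h2 := mul_left_cancel₀ (by simpa using hp0) h1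
  intro m hm
  by_contra hne
  have h3 := coeff_coeff_gradeHom (fun _ => 1) q k m
  rw [h2, Polynomial.coeff_monomial_same] at h3
  have h4 : ∑ i, 1 * m i ≠ k := by
    rw [Finsupp.weight_apply, Finsupp.sum_fintype _ _ (by simp)] at hne
    simpa using hne
  rw [if_neg h4] at h3
  exact hm h3

theorem le_natDegree_gradeHom {n : ℕ} (w : Fin n → ℕ) {p : MvPolynomial (Fin n) ℂ}
    {m : Fin n →₀ ℕ} (hm : coeff m p ≠ 0) : ∑ i, w i * m i ≤ (gradeHom w p).natDegree := by
  refine Polynomial.le_natDegree_of_ne_zero fun h => hm ?_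
  have := coeff_coeff_gradeHom w p (∑ i, w i * m i) m
  rw [h, if_pos rfl] at this
  simpa using this.symm

theorem natDegree_gradeHom_le {n : ℕ} (w : Fin n → ℕ) {p : MvPolynomial (Fin n) ℂ} {k : ℕ}
    (h : ∀ m : Fin n →₀ ℕ, coeff m p ≠ 0 → ∑ i, w i * m i ≤ k) :
    (gradeHom w p).natDegree ≤ k := by
  refine Polynomial.natDegree_le_iff_coeff_eq_zero.2 fun N hN => ?_
  ext m
  rw [coeff_coeff_gradeHom]
  split_ifs with h1
  · by_contra h2
    exact absurd (h m (by simpa using h2)) (by omega)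
  · simp

theorem gradeHom_ne_zero {n : ℕ} (w : Fin n → ℕ) {p : MvPolynomial (Fin n) ℂ} (hp : p ≠ 0) :
    gradeHom w p ≠ 0 := by
  intro h
  apply hp
  ext m
  have := coeff_coeff_gradeHom w p (∑ i, w i * m i) m
  rw [h, if_pos rfl] at this
  simpa using this.symm

/-- Among the rearrangements of an antitone sequence, it has itself the largest partial sums. -/
theorem sum_Iic_comp_perm_le {n : ℕ} {f : Fin n → ℕ} (hf : Antitone f) (π : Equiv.Perm (Fin n))
    (r : Fin n) : ∑ i ∈ Finset.Iic r, f (π i) ≤ ∑ i ∈ Finset.Iic r, f i := by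
  have hg : Antitone fun i : Fin n => if i ≤ r then 1 else 0 := by
    intro i j hij
    dsimp only
    split_ifs with h1 h2 <;> omega
  have h := (hg.monovary hf).sum_mul_comp_perm_le_sum_mul (σ := π)
  simpa [Finset.sum_ite, Finset.filter_ge_eq_Iic] using h

theorem sum_Iic_eq_sum_mul {n : ℕ} (f : Fin n → ℕ) (r : Fin n) :
    ∑ i, (if i ≤ r then 1 else 0) * f i = ∑ i ∈ Finset.Iic r, f i := by
  simp [Finset.sum_ite, Finset.filter_ge_eq_Iic]

/-- With weight 1 on the first variables up to `r` and 0 on the others, the weighted degree is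
additive under products. The degrees of the two alternants are controlled by partial sums of
`staircase n` and `l + staircase n`; their difference bounds that of the quotient. -/
theorem sum_Iic_le_of_coeff_schurQuotient_ne_zero {n : ℕ} {l : Fin n → ℕ} (hl : Antitone l)
    {m : Fin n →₀ ℕ} (hm : coeff m (schurQuotient (l + staircase n)) ≠ 0) (r : Fin n) :
    ∑ i ∈ Finset.Iic r, m i ≤ ∑ i ∈ Finset.Iic r, l i := by
  set w : Fin n → ℕ := fun i => if i ≤ r then 1 else 0
  have h := congrArg (fun p => (gradeHom w p).natDegree)
    (alternant_staircase_mul_schurQuotient (l + staircase n))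
  simp only [map_mul] at h
  have hs : schurQuotient (l + staircase n) ≠ 0 := fun h => hm (by simp [h])
  rw [Polynomial.natDegree_mul (gradeHom_ne_zero w (alternant_staircase_ne_zero n))
    (gradeHom_ne_zero w hs)] at h
  have h1 : ∑ i ∈ Finset.Iic r, staircase n i ≤
      (gradeHom w (alternant (staircase n))).natDegree := by
    have := le_natDegree_gradeHom w (p := alternant (staircase n)) (m := expo (staircase n))
      (by rw [coeff_alternant_of_strictAnti (strictAnti_staircase n) (strictAnti_staircase n)]
          simp)
    rwa [sum_Iic_eq_sum_mul] at this
  have h2 := le_natDegree_gradeHom w hm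
  rw [sum_Iic_eq_sum_mul] at h2
  have h3 : (gradeHom w (alternant (l + staircase n))).natDegree ≤
      ∑ i ∈ Finset.Iic r, (l + staircase n) i := by
    refine natDegree_gradeHom_le w fun a ha => ?_
    obtain ⟨π, hπ⟩ := exists_of_coeff_alternant_ne_zero ha
    rw [sum_Iic_eq_sum_mul, ← hπ]
    exact sum_Iic_comp_perm_le (hl.add (strictAnti_staircase n).antitone) π r
  simp only [Pi.add_apply, Finset.sum_add_distrib] at h3
  omega

theorem isHomogeneous_schurQuotient {n : ℕ} (l : Fin n → ℕ) :
    (schurQuotient (l + staircase n)).IsHomogeneous (∑ i, l i) := by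
  refine IsHomogeneous.of_mul_left (isHomogeneous_alternant (staircase n))
    (alternant_staircase_ne_zero n) ?_
  rw [alternant_staircase_mul_schurQuotient, ← Finset.sum_add_distrib]
  convert! isHomogeneous_alternant (l + staircase n) using 2
  simp [add_comm]

/-! ### Alternating polynomials -/

/-- A polynomial that changes sign under the transpositions of the variables. -/
def IsAlternating {n : ℕ} (p : MvPolynomial (Fin n) ℂ) : Prop :=
  ∀ π : Equiv.Perm (Fin n), rename π p = (Equiv.Perm.sign π : ℤ) • p

theorem IsAlternating.alternant_mul {n : ℕ} (e : Fin n → ℕ) {p : MvPolynomial (Fin n) ℂ}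
    (hp : p.IsSymmetric) : IsAlternating (alternant e * p) := by
  intro π
  rw [map_mul, rename_alternant, hp π, smul_mul_assoc]

theorem coeff_rename_perm {n : ℕ} (π : Equiv.Perm (Fin n)) (p : MvPolynomial (Fin n) ℂ)
    (f : Fin n → ℕ) : coeff (expo f) (rename π p) = coeff (expo (f ∘ π)) p := by
  have h := coeff_rename_mapDomain π π.injective p (expo (f ∘ π))
  rw [← h]
  congr 1
  ext i
  rw [Finsupp.mapDomain_equiv_apply]
  simp

theorem IsAlternating.coeff_comp {n : ℕ} {p : MvPolynomial (Fin n) ℂ} (hp : IsAlternating p)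
    (π : Equiv.Perm (Fin n)) (f : Fin n → ℕ) :
    coeff (expo (f ∘ π)) p = (Equiv.Perm.sign π : ℤ) • coeff (expo f) p := by
  rw [← coeff_rename_perm, hp π, coeff_smul]

theorem exists_perm_antitone {n : ℕ} (f : Fin n → ℕ) :
    ∃ π : Equiv.Perm (Fin n), Antitone (f ∘ π) := by
  refine ⟨Fin.revPerm.trans (Tuple.sort f), ?_⟩
  have h := Tuple.monotone_sort f
  intro i j hij
  exact h (Fin.rev_le_rev.2 hij)

/-- Coefficients at exponents with a repetition vanish by antisymmetry, and every other exponent is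
a rearrangement of a strictly decreasing one. -/
theorem IsAlternating.ext {n : ℕ} {p q : MvPolynomial (Fin n) ℂ} (hp : IsAlternating p)
    (hq : IsAlternating q)
    (h : ∀ f : Fin n → ℕ, StrictAnti f → coeff (expo f) p = coeff (expo f) q) : p = q := by
  have hz : ∀ {p : MvPolynomial (Fin n) ℂ}, IsAlternating p → ∀ f : Fin n → ℕ,
      ¬ Function.Injective f → coeff (expo f) p = 0 := by
    intro p hp f hf
    simp only [Function.Injective, not_forall] at hf
    obtain ⟨i, j, hfij, hij⟩ := hf
    have h1 := hp.coeff_comp (Equiv.swap i j) f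
    have h2 : f ∘ Equiv.swap i j = f := by
      ext k
      simp only [Function.comp_apply, Equiv.swap_apply_def]
      split_ifs with h3 h4 <;> simp_all
    rw [h2, Equiv.Perm.sign_swap hij] at h1
    simp only [Units.val_neg, Units.val_one, neg_smul, one_smul] at h1
    exact self_eq_neg.1 h1
  ext m
  obtain ⟨f, rfl⟩ : ∃ f : Fin n → ℕ, m = expo f := ⟨m, by ext; simp⟩
  by_cases hf : Function.Injective f
  · obtain ⟨π, hπ⟩ := exists_perm_antitone f
    have hs : StrictAnti (f ∘ π) := hπ.strictAnti_of_injective (hf.comp π.injective)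
    have h1 := h _ hs
    rw [hp.coeff_comp, hq.coeff_comp] at h1
    rcases Int.units_eq_one_or (Equiv.Perm.sign π) with hs | hs <;> simpa [hs] using h1
  · rw [hz hp f hf, hz hq f hf]

/-! ### The operator D₂ conjugated by the Vandermonde product -/

/-- The operator `∑ i, x_i ^ 2 ∂_i ^ 2`. -/
noncomputable def quadEuler {n : ℕ} (p : MvPolynomial (Fin n) ℂ) : MvPolynomial (Fin n) ℂ :=
  ∑ i, X i ^ 2 * pderiv i (pderiv i p)

theorem X_sq_mul_pderiv_pderiv_monomial {n : ℕ} (m : Fin n →₀ ℕ) (a : ℂ) (i : Fin n) :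
    X i ^ 2 * pderiv i (pderiv i (monomial m a)) =
      monomial m ((m i : ℂ) * ((m i : ℂ) - 1) * a) := by
  rw [pderiv_monomial, pderiv_monomial, X_pow_eq_monomial, monomial_mul]
  rcases lt_or_ge (m i) 2 with h | h
  · have h1 : (m i : ℂ) * ((m - Finsupp.single i 1 : Fin n →₀ ℕ) i : ℂ) = 0 := by
      have : m i = 0 ∨ m i = 1 := by omega
      rcases this with h | h <;> simp [h]
    have h2 : (m i : ℂ) * ((m i : ℂ) - 1) = 0 := by
      have : m i = 0 ∨ m i = 1 := by omega
      rcases this with h | h <;> simp [h]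
    rw [mul_assoc a, h1, h2]
    simp
  · have h1 : Finsupp.single i 2 + (m - Finsupp.single i 1 - Finsupp.single i 1) = m := by
      ext j
      by_cases hj : i = j
      · subst hj; simp; omega
      · simp [hj]
    rw [h1]
    congr 1
    simp only [Finsupp.tsub_apply, Finsupp.single_eq_same]
    rw [Nat.cast_sub (by omega)]
    push_cast
    ring

theorem quadEuler_add {n : ℕ} (p q : MvPolynomial (Fin n) ℂ) :
    quadEuler (p + q) = quadEuler p + quadEuler q := by
  simp [quadEuler, mul_add, Finset.sum_add_distrib]

theorem coeff_quadEuler {n : ℕ} (p : MvPolynomial (Fin n) ℂ) (m : Fin n →₀ ℕ) :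
    coeff m (quadEuler p) = (∑ i, (m i : ℂ) * ((m i : ℂ) - 1)) * coeff m p := by
  induction p using MvPolynomial.induction_on' with
  | monomial u a =>
    simp only [quadEuler, X_sq_mul_pderiv_pderiv_monomial, coeff_sum, coeff_monomial]
    rcases eq_or_ne u m with rfl | h
    · simp [Finset.sum_mul]
    · simp [h]
  | add p q hp hq => rw [quadEuler_add, coeff_add, hp, hq, coeff_add, mul_add]

/-- Monomials are eigenvectors, with an eigenvalue invariant under permuting the exponent; all
exponents of an alternant are rearrangements of `e`. -/
theorem quadEuler_alternant {n : ℕ} (e : Fin n → ℕ) :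
    quadEuler (alternant e) = (∑ i, (e i : ℂ) * ((e i : ℂ) - 1)) • alternant e := by
  ext m
  rw [coeff_quadEuler, coeff_smul, smul_eq_mul]
  by_cases h : coeff m (alternant e) = 0
  · simp [h]
  · obtain ⟨π, hπ⟩ := exists_of_coeff_alternant_ne_zero h
    congr 1
    rw [← hπ]
    exact Equiv.sum_comp π fun i => (e i : ℂ) * ((e i : ℂ) - 1)

theorem eval_pderiv_prod {n : ℕ} {ι : Type*} (s : Finset ι) (f : ι → MvPolynomial (Fin n) ℂ)
    (i : Fin n) (x : Fin n → ℂ) (h : ∀ a ∈ s, eval x (f a) ≠ 0) :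
    eval x (pderiv i (∏ a ∈ s, f a)) =
      eval x (∏ a ∈ s, f a) * ∑ a ∈ s, eval x (pderiv i (f a)) / eval x (f a) := by
  classical
  induction s using Finset.induction_on with
  | empty => simp
  | insert a s ha ih =>
    rw [Finset.prod_insert ha, Finset.sum_insert ha, Derivation.leibniz]
    have h1 := h a (Finset.mem_insert_self a s)
    simp only [smul_eq_mul, map_add, map_mul] at ih ⊢
    rw [ih fun b hb => h b (Finset.mem_insert_of_mem hb)]
    field_simp
    ring

theorem eval_alternant_staircase {n : ℕ} (x : Fin n → ℂ) :
    eval x (alternant (staircase n)) = ∏ i : Fin n, ∏ j ∈ Finset.Ioi i, (x i - x j) := by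
  simp [alternant_staircase]

theorem eval_alternant_staircase_ne_zero_iff {n : ℕ} {x : Fin n → ℂ} :
    eval x (alternant (staircase n)) ≠ 0 ↔ Function.Injective x := by
  simp only [eval_alternant_staircase, Finset.prod_ne_zero_iff, Finset.mem_Ioi, Finset.mem_univ,
    true_imp_iff, sub_ne_zero]
  constructor
  · intro h i j hij
    by_contra hne
    rcases lt_or_gt_of_ne hne with h1 | h1
    · exact h _ _ h1 hij
    · exact h _ _ h1 hij.symm
  · intro h i j hij hx
    exact hij.ne (h hx)

/-- This is the logarithmic derivative of the Vandermonde product, the source of the first-order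
part of D₂. -/
theorem eval_pderiv_alternant_staircase {n : ℕ} {x : Fin n → ℂ} (hx : Function.Injective x)
    (i : Fin n) : eval x (pderiv i (alternant (staircase n))) =
      eval x (alternant (staircase n)) * ∑ j ∈ Finset.univ.erase i, 1 / (x i - x j) := by
  rw [alternant_staircase, Finset.prod_sigma', eval_pderiv_prod]
  · congr 1
    rw [← Finset.sum_sigma' (f := fun a b => eval x (pderiv i (X a - X b)) / eval x (X a - X b))]
    have h1 : ∀ a b : Fin n, eval x (pderiv i (X a - X b)) / eval x (X a - X b) =
        (if a = i then 1 / (x a - x b) else 0) + (if b = i then 1 / (x b - x a) else 0) := by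
      intro a b
      simp only [map_sub, pderiv_X, eval_X, Pi.single_apply]
      have h2 : 1 / (x b - x a) = - (1 / (x a - x b)) := by
        rw [← neg_sub, one_div_neg_eq_neg_one_div]
      rw [h2]
      rcases eq_or_ne i a with rfl | h3 <;> rcases eq_or_ne i b with rfl | h4 <;>
        simp_all [Ne.symm, div_eq_mul_inv]
    simp only [h1, Finset.sum_add_distrib]
    have h5 : ∑ a : Fin n, ∑ b ∈ Finset.Ioi a, (if a = i then 1 / (x a - x b) else 0) =
        ∑ b ∈ Finset.Ioi i, 1 / (x i - x b) := by
      rw [Finset.sum_eq_single i]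
      · simp
      · intro b _ hb; simp [hb]
      · simp
    have h6 : ∑ a : Fin n, ∑ b ∈ Finset.Ioi a, (if b = i then 1 / (x b - x a) else 0) =
        ∑ b ∈ Finset.Iio i, 1 / (x i - x b) := by
      simp only [Finset.sum_ite_eq', Finset.mem_Ioi]
      rw [← Finset.sum_filter]
      congr 1
      ext; simp
    rw [h5, h6, ← Finset.sum_union]
    · congr 1
      ext j
      simp [eq_comm, lt_or_lt_iff_ne]
    · rw [Finset.disjoint_left]
      intro j h7 h8
      simp only [Finset.mem_Ioi, Finset.mem_Iio] at h7 h8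
      exact lt_asymm h7 h8
  · rintro ⟨a, b⟩ hab
    simp only [Finset.mem_sigma, Finset.mem_univ, Finset.mem_Ioi, true_and] at hab
    simpa [sub_ne_zero] using fun h => hab.ne (hx h)

/-- In the Leibniz expansion of the second derivatives of V f, the cross terms 2 x_i² ∂_i V ∂_i f
give exactly V times the first-order part of D₂ at σ = 1. The terms with ∂_i² V contribute the
constant, since V is itself an eigenvector. -/
theorem eval_alternant_staircase_mul_jackD {n : ℕ} (f : MvPolynomial (Fin n) ℂ) {x : Fin n → ℂ}
    (hx : Function.Injective x) :
    eval x (alternant (staircase n)) * jackD 1 2 f x =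
      eval x (quadEuler (alternant (staircase n) * f)) -
        (∑ i, (staircase n i : ℂ) * ((staircase n i : ℂ) - 1)) *
          eval x (alternant (staircase n) * f) := by
  have h1 := congrArg (eval x) (quadEuler_alternant (staircase n))
  rw [smul_eval] at h1
  generalize ∑ i, (staircase n i : ℂ) * ((staircase n i : ℂ) - 1) = e₀ at h1 ⊢
  set V := alternant (staircase n)
  have h2 : eval x (quadEuler (V * f)) = eval x (quadEuler V) * eval x f +
      eval x V * ∑ i, x i ^ 2 * eval x (pderiv i (pderiv i f)) +
      2 * ∑ i, x i ^ 2 * (eval x (pderiv i V) * eval x (pderiv i f)) := by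
    simp only [quadEuler, map_sum, Derivation.leibniz, smul_eq_mul, map_add, map_mul, map_pow,
      eval_X, Finset.sum_mul, Finset.mul_sum, ← Finset.sum_add_distrib]
    exact Finset.sum_congr rfl fun i _ => by ring
  rw [h2, h1]
  have h3 : ∀ i, eval x (pderiv i V) = eval x V * ∑ j ∈ Finset.univ.erase i, 1 / (x i - x j) :=
    eval_pderiv_alternant_staircase hx
  simp only [h3, jackD, map_mul]
  rw [mul_add, ← sub_eq_zero]
  simp only [Finset.mul_sum, Finset.sum_mul, Complex.ofReal_one, div_one]
  have h4 : ∀ i j : Fin n, eval x V * (2 * (x i ^ 2 / (x i - x j) * eval x (pderiv i f))) =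
      2 * (x i ^ 2 * (eval x V * (1 / (x i - x j)) * eval x (pderiv i f))) := fun i j => by ring
  simp only [h4]
  ring

theorem jackD_eigen_iff {n : ℕ} (f : MvPolynomial (Fin n) ℂ) (ev : ℂ) :
    (∀ x : Fin n → ℂ, Function.Injective x → jackD 1 2 f x = ev * eval x f) ↔
      ∀ m : Fin n →₀ ℕ, coeff m (alternant (staircase n) * f) ≠ 0 →
        ∑ i, (m i : ℂ) * ((m i : ℂ) - 1) =
          ∑ i, (staircase n i : ℂ) * ((staircase n i : ℂ) - 1) + ev := by
  set V := alternant (staircase n) with hV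
  set e₀ := ∑ i, (staircase n i : ℂ) * ((staircase n i : ℂ) - 1)
  have hq : (∀ m : Fin n →₀ ℕ, coeff m (V * f) ≠ 0 →
      ∑ i, (m i : ℂ) * ((m i : ℂ) - 1) = e₀ + ev) ↔
      quadEuler (V * f) = (e₀ + ev) • (V * f) := by
    rw [MvPolynomial.ext_iff]
    refine forall_congr' fun m => ?_
    rw [coeff_quadEuler, coeff_smul, smul_eq_mul, mul_eq_mul_right_iff]
    tauto
  rw [hq]
  constructor
  · intro h
    -- The extra factor V makes the identity trivial where coordinates coincide, so it may be tested
    -- at all points.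
    apply mul_left_cancel₀ (alternant_staircase_ne_zero n)
    apply MvPolynomial.funext
    intro x
    rw [map_mul, map_mul, ← hV]
    by_cases hx : Function.Injective x
    · have h1 := eval_alternant_staircase_mul_jackD f hx
      rw [h x hx, ← hV] at h1
      congr 1
      rw [smul_eval, eq_comm, ← sub_eq_zero]
      rw [eq_comm, ← sub_eq_zero] at h1
      rw [map_mul] at h1 ⊢
      linear_combination -h1
    · have : eval x V = 0 := by
        by_contra h0
        exact hx (eval_alternant_staircase_ne_zero_iff.1 h0)
      simp [this]
  · intro h x hx
    have h1 := eval_alternant_staircase_mul_jackD f hx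
    rw [← hV, h, smul_eval, map_mul] at h1
    apply mul_left_cancel₀ (eval_alternant_staircase_ne_zero_iff.2 hx)
    rw [← hV, h1]
    ring

/-! ### Dominance and sums of squares -/

/-- Abel summation, done by induction: lowering the weight from one index to the next costs nothing
because the partial sum is nonnegative. -/
theorem sum_mul_nonneg_of_partial_sums {n : ℕ} (w d : Fin (n + 1) → ℤ) (hw : Antitone w)
    (hd : ∀ r, 0 ≤ ∑ i, if i ≤ r then d i else 0) :
    w (Fin.last n) * ∑ i, d i ≤ ∑ i, w i * d i := by
  induction n with
  | zero => simp
  | succ n ih =>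
    have h1 := ih (w ∘ Fin.castSucc) (d ∘ Fin.castSucc)
      (hw.comp_monotone Fin.strictMono_castSucc.monotone) (fun r => by
        have := hd r.castSucc
        rw [Fin.sum_univ_castSucc] at this
        simpa [(Fin.castSucc_lt_last r).not_ge] using this)
    have h2 := hd (Fin.last n).castSucc
    rw [Fin.sum_univ_castSucc] at h2
    simp only [Fin.castSucc_le_castSucc_iff, Fin.le_last, if_true,
      (Fin.castSucc_lt_last (Fin.last n)).not_ge, if_false, add_zero] at h2
    rw [Fin.sum_univ_castSucc, Fin.sum_univ_castSucc (fun i => w i * d i)]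
    have h3 : w (Fin.last (n + 1)) ≤ w (Fin.last n).castSucc := hw (Fin.le_last _)
    simp only [Function.comp_apply] at h1
    nlinarith [mul_le_mul_of_nonneg_right h3 h2]

/-- A sequence that is dominated by another one with the same sum of squares equals it. -/
theorem eq_of_partial_sums_le {n : ℕ} {m l : Fin n → ℕ} (hm : Antitone m)
    (h : ∀ r, ∑ i ∈ Finset.Iic r, m i ≤ ∑ i ∈ Finset.Iic r, l i)
    (hsq : ∑ i, m i ^ 2 = ∑ i, l i ^ 2) : m = l := by
  cases n with
  | zero => exact Subsingleton.elim _ _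
  | succ n =>
    have hd : ∀ r, 0 ≤ ∑ i, if i ≤ r then ((l i : ℤ) - m i) else 0 := by
      intro r
      have := h r
      zify at this
      rw [← Finset.sum_filter, Finset.filter_ge_eq_Iic, Finset.sum_sub_distrib]
      linarith
    have h1 := sum_mul_nonneg_of_partial_sums (fun i => (m i : ℤ)) (fun i => (l i : ℤ) - m i)
      (fun i j hij => by simpa using hm hij) hd
    have h2 := hd (Fin.last n)
    simp only [Fin.le_last, if_true] at h2
    have h3 : 0 ≤ ∑ i, (m i : ℤ) * ((l i : ℤ) - m i) :=
      le_trans (mul_nonneg (by positivity) h2) h1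
    zify at hsq
    -- Expanding ∑ (l - m)² with equal sums of squares leaves only the cross term, which Abel
    -- summation has shown to be nonpositive.
    have h4 : ∑ i, ((l i : ℤ) - m i) ^ 2 = - (2 * ∑ i, (m i : ℤ) * ((l i : ℤ) - m i)) := by
      have : ∑ i, ((l i : ℤ) - m i) ^ 2 + (2 * ∑ i, (m i : ℤ) * ((l i : ℤ) - m i)) =
          ∑ i, (l i : ℤ) ^ 2 - ∑ i, (m i : ℤ) ^ 2 := by
        rw [Finset.mul_sum, ← Finset.sum_add_distrib, ← Finset.sum_sub_distrib]
        exact Finset.sum_congr rfl fun i _ => by ring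
      linarith
    have h5 : ∑ i, ((l i : ℤ) - m i) ^ 2 = 0 :=
      le_antisymm (by linarith) (Finset.sum_nonneg fun i _ => sq_nonneg _)
    rw [Finset.sum_eq_zero_iff_of_nonneg fun i _ => sq_nonneg _] at h5
    ext i
    have := h5 i (Finset.mem_univ i)
    rw [sq_eq_zero_iff, sub_eq_zero] at this
    exact_mod_cast this.symm

/-! ### Partitions as strictly decreasing exponents -/

theorem add_sub_le_of_strictAnti {n : ℕ} {f : Fin n → ℕ} (hf : StrictAnti f) (k : ℕ) :
    ∀ i j : Fin n, (j : ℕ) = i + k → f j + k ≤ f i := by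
  induction k with
  | zero => intro i j h; obtain rfl : j = i := Fin.ext (by simpa using h); simp
  | succ k ih =>
    intro i j h
    have h1 := ih i ⟨i + k, by omega⟩ rfl
    have h3 : (⟨i + k, by omega⟩ : Fin n) < j := Fin.lt_def.2 (show (i : ℕ) + k < j by omega)
    have h2 := hf h3
    omega

theorem exists_eq_add_staircase {n : ℕ} {f : Fin n → ℕ} (hf : StrictAnti f) :
    ∃ l : IntPartition n, l.1 + staircase n = f := by
  have hs : ∀ i : Fin n, staircase n i = n - (i + 1) := fun i => Fin.val_rev i
  refine ⟨⟨fun i => f i - staircase n i, ?_⟩, ?_⟩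
  · intro i j hij
    have h1 := add_sub_le_of_strictAnti hf ((j : ℕ) - i) i j (by have := Fin.le_def.1 hij; omega)
    have h2 := Fin.le_def.1 hij
    have h3 := hs i
    have h4 := hs j
    dsimp only
    omega
  · ext i
    have hi := i.isLt
    have h1 := add_sub_le_of_strictAnti hf (n - 1 - i) i ⟨n - 1, by omega⟩
      (show n - 1 = (i : ℕ) + (n - 1 - i) by omega)
    have h3 := hs i
    simp only [Pi.add_apply]
    omega

theorem strictAnti_add_staircase {n : ℕ} (l : IntPartition n) :
    StrictAnti (l.1 + staircase n) :=
  l.2.add_strictAnti (strictAnti_staircase n)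

theorem add_staircase_injective {n : ℕ} {l m : IntPartition n}
    (h : l.1 + staircase n = m.1 + staircase n) : l = m :=
  Subtype.ext (add_right_cancel h)

theorem sum_add_staircase {n : ℕ} (l : IntPartition n) :
    ∑ i, (l.1 + staircase n) i = ∑ i, staircase n i + l.size := by
  simp [Finset.sum_add_distrib, IntPartition.size, add_comm]

theorem staircase_cast {n : ℕ} (i : Fin n) : (staircase n i : ℂ) = n - 1 - (i : ℕ) := by
  have h : staircase n i = n - (i + 1) := Fin.val_rev i
  rw [h, Nat.cast_sub (by omega)]
  push_cast
  ring

/-- This matches the eigenvalue prescribed for D₂ with that of `quadEuler` on the alternant. -/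
theorem sum_mul_sub_one_add_staircase {n : ℕ} (l : IntPartition n) :
    ∑ i, (((l.1 + staircase n) i : ℕ) : ℂ) * ((((l.1 + staircase n) i : ℕ) : ℂ) - 1) =
      ∑ i, (staircase n i : ℂ) * ((staircase n i : ℂ) - 1) +
        (jackRho 1 l + 2 / ((1 : ℝ) : ℂ) * (l.size : ℂ) * ((n : ℂ) - 1)) := by
  have h1 : 2 / ((1 : ℝ) : ℂ) * (l.size : ℂ) * ((n : ℂ) - 1) =
      ∑ i, 2 * (l.1 i : ℂ) * ((n : ℂ) - 1) := by
    rw [IntPartition.size]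
    push_cast
    rw [div_one, Finset.mul_sum, Finset.sum_mul]
  rw [h1, jackRho, ← Finset.sum_add_distrib, ← Finset.sum_add_distrib]
  refine Finset.sum_congr rfl fun i _ => ?_
  rw [Pi.add_apply, Nat.cast_add, staircase_cast]
  push_cast
  ring

/-! ### The Jack polynomials at σ = 1 -/

/-- Triangularity speaks of sorted exponents only; symmetry carries it to all exponents, since
sorting can only increase partial sums. -/
theorem sum_Iic_le_of_coeff_ne_zero {n : ℕ} {C : IntPartition n → MvPolynomial (Fin n) ℂ}
    (hC : IsJackFamily 1 C) (l : IntPartition n) {m : Fin n →₀ ℕ} (hm : coeff m (C l) ≠ 0)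
    (r : Fin n) : ∑ i ∈ Finset.Iic r, m i ≤ ∑ i ∈ Finset.Iic r, l.1 i := by
  obtain ⟨π, hπ⟩ := exists_perm_antitone m
  have h1 : coeff (expo (m ∘ π)) (C l) ≠ 0 := by
    rw [← coeff_rename_perm, hC.symm l π]
    convert! hm
    ext; simp
  have h2 := (hC.triangular l ⟨m ∘ π, hπ⟩ h1).2 r
  refine le_trans ?_ h2
  simpa using sum_Iic_comp_perm_le hπ π⁻¹ r

/-- An exponent of the alternating product has the partial sums of `l.1 + staircase n` as upper
bounds. Homogeneity and the eigenvalue equation give the same sum and sum of squares, so a strictly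
decreasing exponent must be `l.1 + staircase n`. -/
theorem _root_.IsJackFamily.exists_smul_alternant {n : ℕ}
    {C : IntPartition n → MvPolynomial (Fin n) ℂ} (hC : IsJackFamily 1 C) (l : IntPartition n) :
    ∃ c : ℂ, alternant (staircase n) * C l = c • alternant (l.1 + staircase n) := by
  set p := alternant (staircase n) * C l with hp
  have halt : IsAlternating p := IsAlternating.alternant_mul _ (hC.symm l)
  refine ⟨coeff (expo (l.1 + staircase n)) p, halt.ext ?_ ?_⟩
  · intro π
    rw [map_smul, rename_alternant, smul_comm]
  intro m hm
  rw [coeff_smul, coeff_alternant_of_strictAnti (strictAnti_add_staircase l) hm]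
  split_ifs with h
  · simp [h]
  rw [smul_zero]
  by_contra hne
  apply h
  symm
  refine eq_of_partial_sums_le hm.antitone ?_ ?_
  · intro r
    obtain ⟨a, ha, b, hb, hab⟩ := Finset.mem_add.1 (support_mul _ _ (mem_support_iff.2 hne))
    have h1 := sum_Iic_le_of_coeff_ne_zero hC l (mem_support_iff.1 hb) r
    obtain ⟨π, hπ⟩ := exists_of_coeff_alternant_ne_zero (mem_support_iff.1 ha)
    have h2 := sum_Iic_comp_perm_le (strictAnti_staircase n).antitone π r
    have h3 : m = a + b := by
      rw [← Finsupp.coe_add, hab]; ext; simp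
    simp only [h3, ← hπ, Pi.add_apply, Finset.sum_add_distrib, Function.comp_apply]
    omega
  · have h1 := (jackD_eigen_iff (C l) _).1 (hC.eigen l) _ hne
    rw [← sum_mul_sub_one_add_staircase] at h1
    have h2 : ∑ i, m i = ∑ i, (l.1 + staircase n) i := by
      rw [sum_add_staircase]
      have := ((isHomogeneous_alternant (staircase n)).mul (hC.homog l))
      by_contra h
      refine hne (this.coeff_eq_zero ?_)
      simpa [Finsupp.degree_eq_sum] using h
    simp only [mul_sub, mul_one, Finset.sum_sub_distrib] at h1
    have h3 : ∑ i, (m i : ℂ) = ∑ i, (((l.1 + staircase n) i : ℕ) : ℂ) := by exact_mod_cast h2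
    simp only [Finsupp.equivFunOnFinite_symm_apply_apply] at h1
    rw [h3] at h1
    have h4 := sub_left_injective h1
    simp only [← sq] at h4
    exact_mod_cast h4

theorem isSymmetric_sum_X_pow (n k : ℕ) :
    ((∑ i, X i : MvPolynomial (Fin n) ℂ) ^ k).IsSymmetric := by
  intro π
  rw [map_pow, map_sum]
  simp only [rename_X]
  rw [Equiv.sum_comp π (fun i => (X i : MvPolynomial (Fin n) ℂ))]

theorem isHomogeneous_sum_X_pow (n k : ℕ) :
    ((∑ i, X i : MvPolynomial (Fin n) ℂ) ^ k).IsHomogeneous k := by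
  have h : (∑ i, X i : MvPolynomial (Fin n) ℂ).IsHomogeneous 1 :=
    IsHomogeneous.sum _ _ _ fun i _ => isHomogeneous_X ℂ i
  simpa using h.pow k

/-- The coefficient of the Schur polynomial of `l` in `(x₁ + ⋯ + xₙ) ^ |l|`. -/
noncomputable def schurCoeff {n : ℕ} (l : IntPartition n) : ℂ :=
  coeff (expo (l.1 + staircase n)) (alternant (staircase n) * (∑ i, X i) ^ l.size)

/-- In the normalisation identity times the Vandermonde product, only the summand `l` contributes to
the coefficient at `l.1 + staircase n`. -/
theorem _root_.IsJackFamily.alternant_staircase_mul {n : ℕ}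
    {C : IntPartition n → MvPolynomial (Fin n) ℂ} (hC : IsJackFamily 1 C) (l : IntPartition n) :
    alternant (staircase n) * C l = schurCoeff l • alternant (l.1 + staircase n) := by
  choose c hc using IsJackFamily.exists_smul_alternant hC
  rw [hc l]
  congr 1
  rw [schurCoeff, ← hC.normalized, Finset.mul_sum, coeff_sum, Finset.sum_eq_single l]
  · rw [hc l, coeff_smul, coeff_alternant_of_strictAnti (strictAnti_add_staircase l)
      (strictAnti_add_staircase l)]
    simp
  · intro m _ hm
    rw [hc m, coeff_smul, coeff_alternant_of_strictAnti (strictAnti_add_staircase m)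
      (strictAnti_add_staircase l), if_neg fun h => hm (add_staircase_injective h), smul_zero]
  · intro h
    exact absurd ((IntPartition.mem_ofSize l).2 rfl) h

/-- Existence is needed as well as rigidity: without a Jack family, `jackC` would be 0 by
definition. -/
theorem isJackFamily_schur (n : ℕ) : IsJackFamily 1 (fun l : IntPartition n =>
    schurCoeff l • schurQuotient (l.1 + staircase n)) := by
  have hV : ∀ l : IntPartition n, alternant (staircase n) *
      (schurCoeff l • schurQuotient (l.1 + staircase n)) =
      schurCoeff l • alternant (l.1 + staircase n) := fun l => by
    rw [mul_smul_comm, alternant_staircase_mul_schurQuotient]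
  have hhom : ∀ l : IntPartition n,
      (schurCoeff l • schurQuotient (l.1 + staircase n)).IsHomogeneous l.size := fun l => by
    rw [smul_eq_C_mul]
    simpa [IntPartition.size] using (isHomogeneous_C (Fin n) (schurCoeff l)).mul (isHomogeneous_schurQuotient l.1)
  have hsymm : ∀ l : IntPartition n,
      (schurCoeff l • schurQuotient (l.1 + staircase n)).IsSymmetric := fun l =>
    (isSymmetric_schurQuotient _).smul _
  refine ⟨hsymm, hhom, fun l => ?_, fun l μ h => ?_, fun k => ?_⟩
  · refine (jackD_eigen_iff _ _).2 fun m hm => ?_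
    rw [hV, coeff_smul, smul_eq_mul] at hm
    obtain ⟨π, hπ⟩ := exists_of_coeff_alternant_ne_zero (right_ne_zero_of_mul hm)
    rw [← sum_mul_sub_one_add_staircase, ← hπ]
    exact Equiv.sum_comp π fun i => (((l.1 + staircase n) i : ℕ) : ℂ) *
      ((((l.1 + staircase n) i : ℕ) : ℂ) - 1)
  · refine ⟨?_, ?_⟩
    · by_contra hne
      refine h ((hhom l).coeff_eq_zero ?_)
      simpa [Finsupp.degree_eq_sum, IntPartition.size] using hne
    · rw [coeff_smul, smul_eq_mul] at h
      intro r
      simpa using sum_Iic_le_of_coeff_schurQuotient_ne_zero l.2 (right_ne_zero_of_mul h) r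
  · apply mul_left_cancel₀ (alternant_staircase_ne_zero n)
    refine IsAlternating.ext (IsAlternating.alternant_mul _ ?_)
      (IsAlternating.alternant_mul _ (isSymmetric_sum_X_pow n k)) ?_
    · intro π
      rw [map_sum]
      exact Finset.sum_congr rfl fun l _ => hsymm l π
    intro f hf
    obtain ⟨l, rfl⟩ := exists_eq_add_staircase hf
    rw [Finset.mul_sum, coeff_sum]
    have h1 : ∀ m : IntPartition n, coeff (expo (l.1 + staircase n))
        (alternant (staircase n) * (schurCoeff m • schurQuotient (m.1 + staircase n))) =
        if m = l then schurCoeff l else 0 := by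
      intro m
      rw [hV, coeff_smul, coeff_alternant_of_strictAnti (strictAnti_add_staircase m) hf]
      by_cases h : m = l
      · simp [h]
      · rw [if_neg h, if_neg fun h' => h (add_staircase_injective h'), smul_zero]
    rw [Finset.sum_congr rfl fun m _ => h1 m, Finset.sum_ite_eq']
    simp only [IntPartition.mem_ofSize]
    split_ifs with h
    · rw [schurCoeff, h]
    · symm
      refine ((isHomogeneous_alternant _).mul (isHomogeneous_sum_X_pow n k)).coeff_eq_zero ?_
      rw [Finsupp.degree_eq_sum]
      simp only [Finsupp.equivFunOnFinite_symm_apply_apply]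
      rw [sum_add_staircase]
      simpa using h

theorem isJackFamily_jackC (n : ℕ) : IsJackFamily 1 (jackC (n := n) 1) := by
  have h : ∃ C : IntPartition n → MvPolynomial (Fin n) ℂ, IsJackFamily 1 C :=
    ⟨_, isJackFamily_schur n⟩
  rw [jackC, dif_pos h]
  exact h.choose_spec

/-! ### The coefficient of a Schur polynomial in a power of the sum of the variables -/

/-- Row operations turn the powers into any monic polynomials of the same degrees; falling
factorials and their shifts are the cases of interest. -/
theorem eval_alternant_staircase_eq_det {n : ℕ} (p : ℕ → Polynomial ℂ)
    (hdeg : ∀ k, (p k).natDegree = k) (hmon : ∀ k, (p k).Monic) (v : Fin n → ℂ) :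
    eval v (alternant (staircase n)) =
      Matrix.det (Matrix.of fun i j : Fin n => (p (staircase n i)).eval (v j)) := by
  have h := Matrix.det_eval_matrixOfPolynomials_eq_det_vandermonde v (fun i => p i)
    (fun i => hdeg i) (fun i => hmon i)
  have h1 : (Matrix.of fun i j : Fin n => v j ^ staircase n i) =
      (Matrix.vandermonde v).transpose.submatrix Fin.revPerm id := by
    ext i j; simp [staircase, Matrix.vandermonde_apply]
  have h2 : (Matrix.of fun i j : Fin n => (p (staircase n i)).eval (v j)) =
      (Matrix.of fun i j : Fin n => (p j).eval (v i)).transpose.submatrix Fin.revPerm id := by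
    ext i j; simp [staircase]
  rw [eval_alternant, h1, h2, Matrix.det_permute, Matrix.det_permute, Matrix.det_transpose,
    Matrix.det_transpose, h]

/-- Each permutation contributes a signed multinomial coefficient. Pulling out |l|! / ∏ e_i! leaves
falling factorials of the e_i, whose determinant is the Vandermonde product. -/
theorem schurCoeff_eq {n : ℕ} (l : IntPartition n) :
    schurCoeff l = (l.size ! : ℂ) * (∏ i, (((l.1 + staircase n) i)! : ℂ))⁻¹ *
      eval (fun i => (((l.1 + staircase n) i : ℕ) : ℂ)) (alternant (staircase n)) := by
  have hesum := sum_add_staircase l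
  set e := l.1 + staircase n with he
  rw [eval_alternant_staircase_eq_det (fun k => descPochhammer ℂ k)
    (fun k => descPochhammer_natDegree ℂ k) (fun k => monic_descPochhammer ℂ k), Matrix.det_apply',
    schurCoeff, alternant_eq_sum, Finset.sum_mul, coeff_sum, Finset.mul_sum]
  refine Finset.sum_congr rfl fun π _ => ?_
  simp only [Matrix.of_apply, descPochhammer_eval_eq_descFactorial]
  rw [coeff_monomial_mul', ← he]
  split_ifs with h
  · have h' : ∀ i, staircase n (π i) ≤ e i := fun i => h i
    rw [coeff_sum_X_pow_of_fintype, if_pos]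
    · have h1 : ((expo e - expo (staircase n ∘ π)).multinomial : ℂ) *
          ∏ i, ((e i - staircase n (π i))! : ℂ) = (l.size ! : ℂ) := by
        have h2 := Nat.multinomial_spec Finset.univ fun i => e i - staircase n (π i)
        have h3 : (expo e - expo (staircase n ∘ π)).multinomial =
            Nat.multinomial Finset.univ fun i => e i - staircase n (π i) :=
          Finsupp.multinomial_eq_of_support_subset (Finset.subset_univ _)
        have h4 : ∑ i, (e i - staircase n (π i)) = l.size := by
          have h5 : ∑ i, (e i - staircase n (π i)) + ∑ i, staircase n (π i) = ∑ i, e i := by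
            rw [← Finset.sum_add_distrib]
            exact Finset.sum_congr rfl fun i _ => Nat.sub_add_cancel (h' i)
          rw [Equiv.sum_comp π (staircase n), hesum] at h5
          omega
        rw [h4] at h2
        rw [h3, mul_comm]
        exact_mod_cast h2
      have h6 : (∏ i, ((e i)! : ℂ)) = (∏ i, ((e i - staircase n (π i))! : ℂ)) *
          ∏ i, ((e i).descFactorial (staircase n (π i)) : ℂ) := by
        rw [← Finset.prod_mul_distrib]
        refine Finset.prod_congr rfl fun i _ => ?_
        exact_mod_cast (Nat.factorial_mul_descFactorial (h' i)).symm
      have h7 : ∏ i, ((e i - staircase n (π i))! : ℂ) ≠ 0 :=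
        Finset.prod_ne_zero_iff.2 fun i _ => by exact_mod_cast Nat.factorial_ne_zero _
      have h8 : ∏ i, ((e i).descFactorial (staircase n (π i)) : ℂ) ≠ 0 :=
        Finset.prod_ne_zero_iff.2 fun i _ => by
          exact_mod_cast (Nat.descFactorial_eq_zero_iff_lt.not.2 (h' i).not_gt)
      rw [← h1, h6]
      field_simp
    · rw [Finsupp.sum_fintype _ _ (by simp)]
      have h5 : ∑ i, (e i - staircase n (π i)) + ∑ i, staircase n (π i) = ∑ i, e i := by
        rw [← Finset.sum_add_distrib]
        exact Finset.sum_congr rfl fun i _ => Nat.sub_add_cancel (h' i)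
      rw [Equiv.sum_comp π (staircase n), hesum] at h5
      simp only [Finsupp.tsub_apply, Finsupp.equivFunOnFinite_symm_apply_apply,
        Function.comp_apply]
      omega
  -- When the monomial does not divide, the multinomial term is absent, and the falling factorial
  -- vanishes to match.
  · obtain ⟨i, hi⟩ : ∃ i, e i < staircase n (π i) := by
      by_contra! h'
      exact h fun i => h' i
    rw [Finset.prod_eq_zero (f := fun i => ((e i).descFactorial (staircase n (π i)) : ℂ))
      (Finset.mem_univ i), mul_zero, mul_zero]
    exact_mod_cast Nat.descFactorial_eq_zero_iff_lt.2 hi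

theorem jackC_eq_smul_schurQuotient {n : ℕ} (l : IntPartition n) :
    jackC 1 l = schurCoeff l • schurQuotient (l.1 + staircase n) := by
  apply mul_left_cancel₀ (alternant_staircase_ne_zero n)
  rw [(isJackFamily_jackC n).alternant_staircase_mul l, mul_smul_comm,
    alternant_staircase_mul_schurQuotient]

/-! ### Bounds for alternants and Schur polynomials -/

theorem norm_eval_alternant_le {n : ℕ} (e : Fin n → ℕ) (y : Fin n → ℂ) :
    ‖eval y (alternant e)‖ ≤ ∑ π : Equiv.Perm (Fin n), ∏ i, ‖y i‖ ^ e (π i) := by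
  rw [alternant_eq_sum, map_sum]
  refine (norm_sum_le _ _).trans (Finset.sum_le_sum fun π _ => ?_)
  rw [eval_monomial, Finsupp.prod_fintype _ _ (by simp), norm_mul, norm_prod]
  rcases Int.units_eq_one_or (Equiv.Perm.sign π) with h | h <;> simp [h]

theorem norm_eval_alternant_le_factorial_mul_prod {n : ℕ} (y : Fin n → ℕ) :
    ‖eval (fun i => (y i : ℂ)) (alternant (staircase n))‖ ≤ n ! * ∏ i, ((y i : ℝ) + 1) ^ n := by
  refine (norm_eval_alternant_le _ _).trans ?_
  have h : ∀ π : Equiv.Perm (Fin n), ∏ i, ‖(y i : ℂ)‖ ^ staircase n (π i) ≤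
      ∏ i, ((y i : ℝ) + 1) ^ n := by
    intro π
    refine Finset.prod_le_prod (fun i _ => by positivity) fun i _ => ?_
    have h1 : staircase n (π i) ≤ n := (Fin.is_lt _).le
    rw [Complex.norm_natCast]
    calc (y i : ℝ) ^ staircase n (π i) ≤ ((y i : ℝ) + 1) ^ staircase n (π i) := by
          gcongr; linarith
      _ ≤ ((y i : ℝ) + 1) ^ n := pow_le_pow_right₀ (by linarith [(y i).cast_nonneg (α := ℝ)]) h1
  refine (Finset.sum_le_sum fun π _ => h π).trans ?_
  simp [Fintype.card_perm]

/-- A bound of the Schur polynomials on a polydisc, by the maximum modulus principle on a disc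
whose boundary stays away from the zeros of the Vandermonde product. -/
theorem norm_eval_schurQuotient_le {n : ℕ} (e : Fin n → ℕ) {R : ℝ} {x : Fin n → ℂ}
    (hx : ∀ i, ‖x i‖ ≤ R) (hR : 0 ≤ R) :
    ‖eval x (schurQuotient e)‖ ≤ n ! * ∏ i, (R + (2 * R + 1) * n) ^ e i := by
  -- The shifts t · i separate coordinates by at least 2R + 1 when |t| = T, while the x_i differ by
  -- at most 2R; so every factor of the Vandermonde product has modulus at least 1 there.
  set T := 2 * R + 1 with hT
  have hT0 : 0 < T := by positivity
  set y : ℂ → Fin n → ℂ := fun t i => x i + t * ((i : ℕ) : ℂ) with hy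
  have hd : Differentiable ℂ fun t => eval (y t) (schurQuotient e) := by
    intro t
    generalize schurQuotient e = p
    induction p using MvPolynomial.induction_on with
    | C a => simp
    | add p q hp hq => simp only [map_add]; exact hp.add hq
    | mul_X p i hp =>
      simp only [map_mul, eval_X]
      exact hp.mul (by simp only [hy]; fun_prop)
  have h0 : eval x (schurQuotient e) = eval (y 0) (schurQuotient e) := by simp [hy]
  rw [h0]
  refine Complex.norm_le_of_forall_mem_frontier_norm_le (f := fun t => eval (y t) (schurQuotient e))
    (Metric.isBounded_ball (x := (0 : ℂ)) (r := T)) hd.diffContOnCl ?_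
    (subset_closure (Metric.mem_ball_self hT0))
  intro t ht
  rw [frontier_ball _ hT0.ne', mem_sphere_zero_iff_norm] at ht
  have h1 := congrArg (eval (y t)) (alternant_staircase_mul_schurQuotient e)
  rw [map_mul] at h1
  have h2 : 1 ≤ ‖eval (y t) (alternant (staircase n))‖ := by
    rw [eval_alternant_staircase, norm_prod]
    refine Finset.prod_induction _ (1 ≤ ·) (fun a b => one_le_mul_of_one_le_of_one_le) le_rfl
      fun i _ => ?_
    rw [norm_prod]
    refine Finset.prod_induction _ (1 ≤ ·) (fun a b => one_le_mul_of_one_le_of_one_le) le_rfl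
      fun j hj => ?_
    have hij : i < j := Finset.mem_Ioi.1 hj
    have h3 : t * (((j : ℕ) : ℂ) - ((i : ℕ) : ℂ)) = x i - x j - (y t i - y t j) := by
      simp only [hy]; ring
    have h4 : T ≤ ‖t * (((j : ℕ) : ℂ) - ((i : ℕ) : ℂ))‖ := by
      rw [norm_mul, ht, ← Nat.cast_sub hij.le, Complex.norm_natCast]
      have : (1 : ℝ) ≤ ((j - i : ℕ) : ℝ) := by
        exact_mod_cast Nat.sub_pos_of_lt hij
      nlinarith
    rw [h3] at h4
    have h5 := norm_sub_le (x i - x j) (y t i - y t j)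
    have h6 := norm_sub_le (x i) (x j)
    linarith [hx i, hx j]
  calc ‖eval (y t) (schurQuotient e)‖
      ≤ ‖eval (y t) (alternant (staircase n))‖ * ‖eval (y t) (schurQuotient e)‖ :=
        le_mul_of_one_le_left (norm_nonneg _) h2
    _ = ‖eval (y t) (alternant e)‖ := by rw [← norm_mul, h1]
    _ ≤ _ := by
      refine (norm_eval_alternant_le _ _).trans ?_
      have h3 : ∀ π : Equiv.Perm (Fin n), ∏ i, ‖y t i‖ ^ e (π i) ≤
          ∏ i, (R + T * n) ^ e i := by
        intro π
        rw [← Equiv.prod_comp π fun i => (R + T * n) ^ e i]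
        refine Finset.prod_le_prod (fun i _ => by positivity) fun i _ => ?_
        refine pow_le_pow_left₀ (norm_nonneg _) ?_ _
        refine (norm_add_le _ _).trans (add_le_add (hx i) ?_)
        rw [norm_mul, ht, Complex.norm_natCast]
        have : ((i : ℕ) : ℝ) ≤ n := by exact_mod_cast i.is_lt.le
        gcongr
      refine (Finset.sum_le_sum fun π _ => h3 π).trans ?_
      simp [Fintype.card_perm]

end MvPolynomial

open MvPolynomial

/-! ### Bessel coefficients, convergence and continuity -/

/-- A finite set of multi-indices lies in a box, over which the sum factors. -/
theorem summable_pi_prod_of_nonneg {n : ℕ} {u : ℕ → ℝ} (hu : Summable u) (h0 : ∀ m, 0 ≤ u m) :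
    Summable fun l : Fin n → ℕ => ∏ i, u (l i) := by
  refine summable_of_sum_le (c := (∑' m, u m) ^ n)
    (fun l => Finset.prod_nonneg fun i _ => h0 _) fun s => ?_
  have h1 : s ⊆ Fintype.piFinset fun i => s.image fun l => l i := by
    intro l hl
    simp only [Fintype.mem_piFinset, Finset.mem_image]
    exact fun i => ⟨l, hl, rfl⟩
  refine (Finset.sum_le_sum_of_subset_of_nonneg h1 fun l _ _ =>
    Finset.prod_nonneg fun i _ => h0 _).trans ?_
  rw [← Finset.prod_univ_sum (fun i : Fin n => s.image fun l => l i) fun _ m => u m]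
  calc ∏ i : Fin n, ∑ m ∈ s.image (fun l => l i), u m ≤ ∏ _i : Fin n, ∑' m, u m :=
        Finset.prod_le_prod (fun i _ => Finset.sum_nonneg fun m _ => h0 m)
          fun i _ => hu.sum_le_tsum _ fun m _ => h0 m
    _ = _ := by simp

/-- The Taylor coefficients `1 / (m! Γ(a + m + 1))` of the normalised Bessel function. -/
noncomputable def besselCoeff (a : ℂ) (m : ℕ) : ℂ :=
  (m ! : ℂ)⁻¹ * (Complex.Gamma (a + m + 1))⁻¹

/-- By 1/Γ(s) = s/Γ(s + 1), the moduli are nonincreasing in m once m ≥ ‖a‖. -/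
theorem exists_norm_Gamma_inv_le (a : ℂ) :
    ∃ K : ℝ, 0 ≤ K ∧ ∀ m : ℕ, ‖(Complex.Gamma (a + m + 1))⁻¹‖ ≤ K := by
  set b : ℕ → ℝ := fun m => ‖(Complex.Gamma (a + m + 1))⁻¹‖ with hb
  obtain ⟨M, hM⟩ := exists_nat_ge ‖a‖
  have h1 : ∀ m, M ≤ m → b (m + 1) ≤ b m := by
    intro m hm
    have h2 : b m = ‖a + m + 1‖ * b (m + 1) := by
      simp only [hb]
      rw [Complex.one_div_Gamma_eq_self_mul_one_div_Gamma_add_one, norm_mul]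
      push_cast
      ring_nf
    have h3 : 1 ≤ ‖a + m + 1‖ := by
      have h4 := norm_sub_le (a + m + 1) a
      have h5 : a + m + 1 - a = ((m + 1 : ℕ) : ℂ) := by push_cast; ring
      rw [h5, Complex.norm_natCast] at h4
      have : (M : ℝ) ≤ m := by exact_mod_cast hm
      push_cast at h4
      linarith
    rw [h2]
    exact le_mul_of_one_le_left (norm_nonneg _) h3
  refine ⟨∑ i ∈ Finset.range (M + 1), b i, Finset.sum_nonneg fun i _ => norm_nonneg _, fun m => ?_⟩
  have h2 : ∀ i, i ≤ M → b i ≤ ∑ i ∈ Finset.range (M + 1), b i := fun i hi =>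
    Finset.single_le_sum (f := b) (fun i _ => norm_nonneg _) (Finset.mem_range.2 (by omega))
  rcases le_total m M with h | h
  · exact h2 m h
  · induction m, h using Nat.le_induction with
    | base => exact h2 M le_rfl
    | succ m hm ih => exact (h1 m hm).trans ih

theorem summable_pow_mul_besselCoeff (a : ℂ) (k : ℕ) {B : ℝ} (hB : 0 ≤ B) :
    Summable fun m : ℕ => ((m : ℝ) + 1) ^ k * B ^ m * ‖besselCoeff a m‖ := by
  obtain ⟨K, hK0, hK⟩ := exists_norm_Gamma_inv_le a
  refine Summable.of_nonneg_of_le (fun m => by positivity) (fun m => ?_)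
    ((Real.summable_pow_div_factorial (2 ^ k * B)).mul_left K)
  have h1 : ((m : ℝ) + 1) ^ k ≤ (2 ^ k) ^ m := by
    rw [← pow_mul, mul_comm, pow_mul]
    have : (m : ℝ) + 1 ≤ 2 ^ m := by exact_mod_cast Nat.lt_two_pow_self
    gcongr
  rw [besselCoeff, norm_mul, norm_inv, Complex.norm_natCast, mul_pow]
  calc ((m : ℝ) + 1) ^ k * B ^ m * ((m ! : ℝ)⁻¹ * ‖(Complex.Gamma (a + m + 1))⁻¹‖)
      ≤ (2 ^ k) ^ m * B ^ m * ((m ! : ℝ)⁻¹ * K) := by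
        gcongr
        exact hK m
    _ = _ := by ring

/-- Stated with 1/Γ so that it holds at the poles too, where the inverse is 0. -/
theorem ascPochhammer_eval_mul_Gamma_inv (s : ℂ) (m : ℕ) :
    (ascPochhammer ℂ m).eval s * (Complex.Gamma (s + m))⁻¹ = (Complex.Gamma s)⁻¹ := by
  induction m with
  | zero => simp
  | succ m ih =>
    rw [← ih, Complex.one_div_Gamma_eq_self_mul_one_div_Gamma_add_one (s + m),
      ascPochhammer_succ_eval]
    push_cast
    ring_nf

/-- The product `∏ i, Γ(c + 1 - i)`. -/
noncomputable def gammaProd (n : ℕ) (c : ℂ) : ℂ :=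
  ∏ i : Fin n, Complex.Gamma (c + 1 - (((i : ℕ) : ℂ) + 1))

/-- Since c - i + l_i = c - n + e_i + 1 for the zero-based index i, the i-th factor depends on i
only through e_i, apart from the Γ-value collected in `gammaProd`. -/
theorem genPochhammer_one_inv {n : ℕ} {c : ℂ}
    (hc : ∀ i : ℕ, i < n → ∀ m : ℕ, c - (i : ℂ) ≠ -(m : ℂ)) (l : IntPartition n) :
    (genPochhammer 1 l c)⁻¹ = gammaProd n c *
      ∏ i, (Complex.Gamma (c - n + ((l.1 + staircase n) i : ℕ) + 1))⁻¹ := by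
  rw [genPochhammer, gammaProd, ← Finset.prod_inv_distrib, ← Finset.prod_mul_distrib]
  refine Finset.prod_congr rfl fun i _ => ?_
  have h1 := ascPochhammer_eval_mul_Gamma_inv (c - (i : ℕ)) (l.1 i)
  have h2 : Complex.Gamma (c - (i : ℕ)) ≠ 0 := Complex.Gamma_ne_zero (hc i i.is_lt)
  have h4 : c - n + ((l.1 + staircase n) i : ℕ) + 1 = c - (i : ℕ) + l.1 i := by
    rw [Pi.add_apply, Nat.cast_add, staircase_cast]; ring
  have h5 : c + 1 - (((i : ℕ) : ℂ) + 1) = c - (i : ℕ) := by ring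
  rw [h4, h5, Complex.ofReal_one, div_one]
  have h6 : (ascPochhammer ℂ (l.1 i)).eval (c - (i : ℕ)) ≠ 0 := by
    intro h
    rw [h, zero_mul] at h1
    exact inv_ne_zero h2 h1.symm
  rw [inv_eq_iff_eq_inv, mul_inv, inv_inv, ← h1]
  rw [mul_assoc, inv_mul_cancel₀, mul_one]
  intro h
  rw [h, inv_zero, mul_zero] at h1
  exact inv_ne_zero h2 h1.symm

theorem mvHypTerm_zero_one {n : ℕ} {c : ℂ}
    (hc : ∀ i : ℕ, i < n → ∀ m : ℕ, c - (i : ℂ) ≠ -(m : ℂ)) (x : Fin n → ℂ) (l : IntPartition n) :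
    mvHypTerm 1 [] [c] x l = gammaProd n c *
      (eval (fun i => (((l.1 + staircase n) i : ℕ) : ℂ)) (alternant (staircase n)) *
        ∏ i, besselCoeff (c - n) ((l.1 + staircase n) i)) *
      eval x (schurQuotient (l.1 + staircase n)) := by
  have h1 : (l.size ! : ℂ) ≠ 0 := by exact_mod_cast Nat.factorial_ne_zero _
  rw [mvHypTerm, jackC_eq_smul_schurQuotient, smul_eval, schurCoeff_eq]
  simp only [List.map_nil, List.prod_nil, List.map_cons, List.prod_cons, mul_one, besselCoeff,
    Finset.prod_mul_distrib]
  rw [one_div, mul_inv, genPochhammer_one_inv hc, Finset.prod_inv_distrib]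
  rw [Finset.prod_inv_distrib]
  field_simp

/-- A summable bound of the terms of the series `₀F₁` on a polydisc. -/
noncomputable def termBound (n : ℕ) (c : ℂ) (R : ℝ) (l : IntPartition n) : ℝ :=
  ‖gammaProd n c‖ * n ! * n ! * ∏ i, ((((l.1 + staircase n) i : ℕ) : ℝ) + 1) ^ n *
    (R + (2 * R + 1) * n) ^ ((l.1 + staircase n) i) *
      ‖besselCoeff (c - n) ((l.1 + staircase n) i)‖

theorem summable_termBound (n : ℕ) (c : ℂ) {R : ℝ} (hR : 0 ≤ R) :
    Summable (termBound n c R) := by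
  have hu := summable_pow_mul_besselCoeff (c - n) n (B := R + (2 * R + 1) * n) (by positivity)
  have h1 := (summable_pi_prod_of_nonneg (n := n) hu fun m => by positivity).comp_injective
    (i := fun l : IntPartition n => l.1 + staircase n) fun l m h => add_staircase_injective h
  exact h1.mul_left (‖gammaProd n c‖ * n ! * n !)

theorem norm_mvHypTerm_le {n : ℕ} {c : ℂ}
    (hc : ∀ i : ℕ, i < n → ∀ m : ℕ, c - (i : ℂ) ≠ -(m : ℂ)) {R : ℝ} (hR : 0 ≤ R)
    {x : Fin n → ℂ} (hx : ∀ i, ‖x i‖ ≤ R) (l : IntPartition n) :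
    ‖mvHypTerm 1 [] [c] x l‖ ≤ termBound n c R l := by
  rw [mvHypTerm_zero_one hc, norm_mul, norm_mul, norm_mul, norm_prod, termBound]
  simp only [Finset.prod_mul_distrib]
  set e := l.1 + staircase n
  calc ‖gammaProd n c‖ * (‖eval (fun i => ((e i : ℕ) : ℂ)) (alternant (staircase n))‖ *
          ∏ i, ‖besselCoeff (c - n) (e i)‖) * ‖eval x (schurQuotient e)‖
      ≤ ‖gammaProd n c‖ * ((n ! * ∏ i, ((e i : ℝ) + 1) ^ n) *
          ∏ i, ‖besselCoeff (c - n) (e i)‖) * (n ! * ∏ i, (R + (2 * R + 1) * n) ^ e i) := by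
        have := norm_eval_alternant_le_factorial_mul_prod e
        have := norm_eval_schurQuotient_le e hx hR
        have : 0 ≤ ∏ i, ‖besselCoeff (c - n) (e i)‖ := Finset.prod_nonneg fun i _ => norm_nonneg _
        gcongr
    _ = _ := by ring

theorem summable_mvHypTerm {n : ℕ} {c : ℂ}
    (hc : ∀ i : ℕ, i < n → ∀ m : ℕ, c - (i : ℂ) ≠ -(m : ℂ)) (x : Fin n → ℂ) :
    Summable (fun l : IntPartition n => mvHypTerm 1 [] [c] x l) :=
  Summable.of_norm_bounded (summable_termBound n c (norm_nonneg x))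
    (norm_mvHypTerm_le hc (norm_nonneg x) (norm_le_pi_norm x))

theorem continuous_mvHyp {n : ℕ} {c : ℂ}
    (hc : ∀ i : ℕ, i < n → ∀ m : ℕ, c - (i : ℂ) ≠ -(m : ℂ)) :
    Continuous (fun x : Fin n → ℂ => mvHyp 1 [] [c] x) := by
  rw [continuous_iff_continuousAt]
  intro x
  -- Weierstrass test on a ball, with the bound of the terms taken at its radius.
  have h : ContinuousOn (fun x : Fin n → ℂ => mvHyp 1 [] [c] x) (Metric.ball 0 (‖x‖ + 1)) := by
    refine continuousOn_tsum (fun l => ?_)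
      (summable_termBound n c (by positivity : 0 ≤ ‖x‖ + 1)) fun l y hy => ?_
    · unfold mvHypTerm
      exact (continuous_const.mul (MvPolynomial.continuous_eval _)).continuousOn
    · rw [mem_ball_zero_iff] at hy
      exact norm_mvHypTerm_le hc (by positivity) (fun i => (norm_le_pi_norm y i).trans hy.le) l
  exact h.continuousAt (Metric.isOpen_ball.mem_nhds (by simp))

/-! ### Cauchy–Binet -/

/-- The Cauchy–Binet formula for sequences of vectors. -/
theorem det_sum_mul_eq_sum_det_mul_det {n : ℕ} (N : ℕ) (f g : Fin n → ℕ → ℂ) :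
    Matrix.det (Matrix.of fun i j => ∑ m ∈ Finset.range N, f j m * g i m) =
      ∑ l ∈ (Fintype.piFinset fun _ : Fin n => Finset.range N),
        open Classical in if StrictAnti l then
          Matrix.det (Matrix.of fun i j => f j (l i)) *
            Matrix.det (Matrix.of fun i j => g i (l j)) else 0 := by
  classical
  set P := Fintype.piFinset fun _ : Fin n => Finset.range N with hP
  set D : (Fin n → ℕ) → ℂ := fun l => Matrix.det (Matrix.of fun i j => g i (l j)) with hD
  have hDperm : ∀ (l : Fin n → ℕ) (π : Equiv.Perm (Fin n)),
      D (l ∘ π) = ((Equiv.Perm.sign π : ℤ) : ℂ) * D l := fun l π =>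
    Matrix.det_permute' π (Matrix.of fun i j => g i (l j))
  have hDinj : ∀ l, ¬ Function.Injective l → D l = 0 := by
    intro l hl
    simp only [Function.Injective, not_forall] at hl
    obtain ⟨i, j, hij, hne⟩ := hl
    exact Matrix.det_zero_of_column_eq hne fun k => by simp [hij]
  -- Multilinearity in the columns.
  have h1 : Matrix.det (Matrix.of fun i j => ∑ m ∈ Finset.range N, f j m * g i m) =
      ∑ l ∈ P, (∏ i, f i (l i)) * D l := by
    simp only [Matrix.det_apply', Matrix.of_apply, hD, Finset.prod_univ_sum, Finset.mul_sum]
    rw [Finset.sum_comm]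
    refine Finset.sum_congr rfl fun l _ => Finset.sum_congr rfl fun π _ => ?_
    rw [Finset.prod_mul_distrib]
    ring
  rw [h1, ← Finset.sum_filter, ← Finset.sum_filter_of_ne (p := Function.Injective)
    (s := P) (f := fun l => (∏ i, f i (l i)) * D l)
    (fun l _ hl => by_contra fun h => hl (by simp only [hDinj l h, mul_zero]))]
  have h2 : ∀ l : Fin n → ℕ, Matrix.det (Matrix.of fun i j => f j (l i)) * D l =
      ∑ π : Equiv.Perm (Fin n), (∏ i, f i ((l ∘ π) i)) * D (l ∘ π) := by
    intro l
    rw [Matrix.det_apply', Finset.sum_mul]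
    refine Finset.sum_congr rfl fun π _ => ?_
    rw [hDperm]
    simp only [Matrix.of_apply, Function.comp_apply]
    ring
  rw [Finset.sum_congr rfl fun l _ => h2 l, ← Finset.sum_product']
  symm
  -- An injective sequence is in exactly one way a strictly decreasing one composed with a
  -- permutation.
  refine Finset.sum_bij (fun lπ _ => lπ.1 ∘ lπ.2) ?_ ?_ ?_ ?_
  · rintro ⟨l, π⟩ h
    simp only [Finset.mem_product, Finset.mem_filter, Finset.mem_univ, and_true] at h
    simp only [Finset.mem_filter, hP, Fintype.mem_piFinset] at h ⊢
    exact ⟨fun i => h.1 (π i), h.2.injective.comp π.injective⟩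
  · rintro ⟨l, π⟩ h ⟨l', π'⟩ h' heq
    simp only [Finset.mem_product, Finset.mem_filter, Finset.mem_univ, and_true] at h h'
    have h3 : l ∘ (π * π'⁻¹ : Equiv.Perm (Fin n)) = l' := by
      ext i
      have := congrFun heq (π'⁻¹ i)
      simpa using this
    have h4 := strictAnti_comp_perm h.2 h'.2 _ h3
    rw [h4] at h3
    rw [mul_inv_eq_one.1 h4, ← h3]
    rfl
  · intro l hl
    simp only [Finset.mem_filter, hP, Fintype.mem_piFinset] at hl
    obtain ⟨π, hπ⟩ := exists_perm_antitone l
    refine ⟨(l ∘ π, π⁻¹), ?_, ?_⟩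
    · simp only [Finset.mem_product, Finset.mem_filter, Finset.mem_univ, and_true, hP,
        Fintype.mem_piFinset]
      exact ⟨fun i => hl.1 (π i), hπ.strictAnti_of_injective (hl.2.comp π.injective)⟩
    · ext i; simp
  · intro _ _; rfl

/-- The Cauchy–Binet formula for series, summed over partitions. -/
theorem tsum_det_mul_det {n : ℕ} (f g : Fin n → ℕ → ℂ)
    (hfg : ∀ i j, Summable fun m => f j m * g i m)
    (hs : Summable fun l : IntPartition n =>
      Matrix.det (Matrix.of fun i j => f j ((l.1 + staircase n) i)) *
        Matrix.det (Matrix.of fun i j => g i ((l.1 + staircase n) j))) :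
    ∑' l : IntPartition n, Matrix.det (Matrix.of fun i j => f j ((l.1 + staircase n) i)) *
        Matrix.det (Matrix.of fun i j => g i ((l.1 + staircase n) j)) =
      Matrix.det (Matrix.of fun i j => ∑' m, f j m * g i m) := by
  classical
  set F : (Fin n → ℕ) → ℂ := fun l => if StrictAnti l then
    Matrix.det (Matrix.of fun i j => f j (l i)) *
      Matrix.det (Matrix.of fun i j => g i (l j)) else 0 with hF
  have hinj : Function.Injective fun l : IntPartition n => l.1 + staircase n :=
    fun l m h => add_staircase_injective h
  have h1 : HasSum F (∑' l : IntPartition n,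
      Matrix.det (Matrix.of fun i j => f j ((l.1 + staircase n) i)) *
        Matrix.det (Matrix.of fun i j => g i ((l.1 + staircase n) j))) := by
    refine (hinj.hasSum_iff fun l hl => ?_).1 ?_
    · refine if_neg fun h => hl ?_
      obtain ⟨m, hm⟩ := exists_eq_add_staircase h
      exact ⟨m, hm⟩
    · convert! hs.hasSum using 2 with l
      simp only [Function.comp_apply, hF, if_pos (strictAnti_add_staircase l)]
  -- The boxes exhaust all multi-indices, so the unconditional sum is the limit of the finite
  -- formula over them.
  have h2 : Filter.Tendsto (fun N : ℕ => Fintype.piFinset fun _ : Fin n => Finset.range N)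
      Filter.atTop Filter.atTop := by
    refine Filter.tendsto_atTop_finset_of_monotone (fun N M h => ?_) fun l => ?_
    · exact Fintype.piFinset_subset _ _ fun _ => Finset.range_mono h
    · refine ⟨∑ i, l i + 1, ?_⟩
      simp only [Fintype.mem_piFinset, Finset.mem_range, Nat.lt_succ_iff]
      exact fun i => Finset.single_le_sum (fun _ _ => Nat.zero_le _) (Finset.mem_univ i)
  have h3 : Filter.Tendsto (fun N : ℕ => Matrix.det (Matrix.of fun i j =>
      ∑ m ∈ Finset.range N, f j m * g i m)) Filter.atTop
      (nhds (Matrix.det (Matrix.of fun i j => ∑' m, f j m * g i m))) := by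
    have hc : Continuous fun M : Matrix (Fin n) (Fin n) ℂ => M.det := continuous_id.matrix_det
    refine (hc.tendsto _).comp ?_
    refine tendsto_pi_nhds.2 fun i => tendsto_pi_nhds.2 fun j => ?_
    exact (hfg i j).tendsto_sum_tsum_nat
  refine tendsto_nhds_unique (h1.comp h2) ?_
  refine h3.congr fun N => ?_
  exact det_sum_mul_eq_sum_det_mul_det N f g

/-! ### The determinant for distinct coordinates -/

/-- The entire function `∑ k, z ^ k / (k! Γ(ν + k + 1))`. -/
noncomputable def besselSeries (ν z : ℂ) : ℂ := ∑' k : ℕ, z ^ k * besselCoeff ν k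

theorem summable_pow_mul_besselCoeff' (ν z : ℂ) : Summable fun k : ℕ => z ^ k * besselCoeff ν k := by
  have h := summable_pow_mul_besselCoeff ν 0 (norm_nonneg z)
  refine Summable.of_norm ?_
  simpa using h

theorem besselI_two_mul_sqrt (ν z : ℂ) :
    besselI ν (2 * z ^ (1 / 2 : ℂ)) = z ^ (ν / 2) * besselSeries ν z := by
  have h1 : 2 * z ^ (1 / 2 : ℂ) / 2 = z ^ (1 / 2 : ℂ) := by ring
  have h2 : (z ^ (1 / 2 : ℂ)) ^ ν = z ^ (ν / 2) := by
    -- Halving puts the argument in (-π/2, π/2], so the iterated principal power is a single one.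
    have h3 : (Complex.log z * (1 / 2 : ℂ)).im = Complex.arg z / 2 := by
      rw [show Complex.log z * (1 / 2 : ℂ) = Complex.log z / (2 : ℝ) by push_cast; ring,
        Complex.div_ofReal_im, Complex.log_im]
    have hp := Real.pi_pos
    rw [← Complex.cpow_mul]
    · ring_nf
    · rw [h3]; linarith [Complex.neg_pi_lt_arg z]
    · rw [h3]; linarith [Complex.arg_le_pi z]
  rw [besselI, h1, h2, besselSeries]
  congr 1
  refine tsum_congr fun k => ?_
  rw [pow_mul]
  have h4 : (z ^ (1 / 2 : ℂ)) ^ 2 = z := by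
    rw [one_div]; exact Complex.cpow_nat_inv_pow z two_ne_zero
  rw [h4, besselCoeff, div_eq_mul_inv, mul_inv]

/-- The monic polynomial `∏_{t < k} (a + X - t)`. -/
noncomputable def shiftedDescPochhammer (a : ℂ) (k : ℕ) : Polynomial ℂ :=
  (descPochhammer ℂ k).comp (Polynomial.X + Polynomial.C a)

theorem natDegree_shiftedDescPochhammer (a : ℂ) (k : ℕ) :
    (shiftedDescPochhammer a k).natDegree = k := by
  rw [shiftedDescPochhammer, Polynomial.natDegree_comp, descPochhammer_natDegree,
    Polynomial.natDegree_X_add_C, mul_one]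

theorem monic_shiftedDescPochhammer (a : ℂ) (k : ℕ) : (shiftedDescPochhammer a k).Monic :=
  (monic_descPochhammer ℂ k).comp_X_add_C a

/-- Each factor a + m - t is absorbed by the functional equation of Γ and lowers the index by one.
-/
theorem shiftedDescPochhammer_eval_mul_besselCoeff (a : ℂ) (k m : ℕ) :
    (shiftedDescPochhammer a k).eval (m : ℂ) * besselCoeff a m = besselCoeff (a - k) m := by
  rw [shiftedDescPochhammer, Polynomial.eval_comp]
  induction k with
  | zero => simp
  | succ k ih =>
    rw [descPochhammer_succ_eval, mul_right_comm, ih]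
    simp only [besselCoeff, Polynomial.eval_add, Polynomial.eval_X, Polynomial.eval_C]
    have h := Complex.one_div_Gamma_eq_self_mul_one_div_Gamma_add_one
      (a - ((k + 1 : ℕ) : ℂ) + m + 1)
    rw [h]
    push_cast
    ring_nf

theorem eval_alternant_mul_prod_besselCoeff {n : ℕ} (a : ℂ) (e : Fin n → ℕ) :
    eval (fun i => ((e i : ℕ) : ℂ)) (alternant (staircase n)) * ∏ i, besselCoeff a (e i) =
      Matrix.det (Matrix.of fun i j : Fin n => besselCoeff (a - staircase n i) (e j)) := by
  rw [eval_alternant_staircase_eq_det (shiftedDescPochhammer a) (natDegree_shiftedDescPochhammer a)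
    (monic_shiftedDescPochhammer a), mul_comm, ← Matrix.det_mul_row]
  congr 1
  ext i j
  simp only [Matrix.of_apply]
  rw [← shiftedDescPochhammer_eval_mul_besselCoeff, mul_comm]

/-- The Vandermonde factor turns each Schur polynomial into an alternant, so every term is a product
of two determinants and Cauchy–Binet sums the series. -/
theorem eval_alternant_mul_mvHyp {n : ℕ} {c : ℂ}
    (hc : ∀ i : ℕ, i < n → ∀ m : ℕ, c - (i : ℂ) ≠ -(m : ℂ)) (x : Fin n → ℂ) :
    eval x (alternant (staircase n)) * mvHyp 1 [] [c] x = gammaProd n c *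
      Matrix.det (Matrix.of fun i j : Fin n => besselSeries (c - n - staircase n i) (x j)) := by
  by_cases hG : gammaProd n c = 0
  · simp [mvHyp, mvHypTerm_zero_one hc, hG]
  have hterm : ∀ l : IntPartition n, gammaProd n c *
      (Matrix.det (Matrix.of fun i j => x j ^ ((l.1 + staircase n) i)) *
        Matrix.det (Matrix.of fun i j => besselCoeff (c - n - staircase n i)
          ((l.1 + staircase n) j))) =
      eval x (alternant (staircase n)) * mvHypTerm 1 [] [c] x l := by
    intro l
    rw [mvHypTerm_zero_one hc, eval_alternant_mul_prod_besselCoeff, ← eval_alternant,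
      ← alternant_staircase_mul_schurQuotient, map_mul]
    ring
  have hs := (summable_mvHypTerm hc x).mul_left (eval x (alternant (staircase n)))
  simp only [← hterm] at hs
  rw [summable_mul_left_iff hG] at hs
  have h := tsum_det_mul_det (fun j m => x j ^ m)
    (fun i m => besselCoeff (c - n - staircase n i) m)
    (fun i j => summable_pow_mul_besselCoeff' _ _) hs
  rw [mvHyp, ← tsum_mul_left]
  simp only [← hterm]
  rw [tsum_mul_left, h]
  rfl

/-! ### The determinant for equal coordinates -/

/-- The factor of `∏_{i < j} (q ^ e_i - q ^ e_j)` that does not vanish at `q = 1`. -/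
noncomputable def geomProd {n : ℕ} (e : Fin n → ℕ) (q : ℂ) : ℂ :=
  ∏ i : Fin n, ∏ j ∈ Finset.Ioi i, q ^ e j * ∑ k ∈ Finset.range (e i - e j), q ^ k

theorem eval_pow_alternant_staircase {n : ℕ} {e : Fin n → ℕ} (he : Antitone e) (q : ℂ) :
    eval (fun i => q ^ e i) (alternant (staircase n)) =
      (∏ i : Fin n, ∏ _j ∈ Finset.Ioi i, (q - 1)) * geomProd e q := by
  rw [eval_alternant_staircase, geomProd, ← Finset.prod_mul_distrib]
  refine Finset.prod_congr rfl fun i _ => ?_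
  rw [← Finset.prod_mul_distrib]
  refine Finset.prod_congr rfl fun j hj => ?_
  have h1 := geom_sum_mul q (e i - e j)
  have h2 : q ^ e i = q ^ e j * q ^ (e i - e j) := by
    rw [← pow_add, Nat.add_sub_cancel' (he (Finset.mem_Ioi.1 hj).le)]
  rw [h2]
  linear_combination -(q ^ e j) * h1

theorem geomProd_one {n : ℕ} {e : Fin n → ℕ} (he : Antitone e) :
    geomProd e 1 = eval (fun i => ((e i : ℕ) : ℂ)) (alternant (staircase n)) := by
  rw [eval_alternant_staircase, geomProd]
  refine Finset.prod_congr rfl fun i _ => Finset.prod_congr rfl fun j hj => ?_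
  have := he (Finset.mem_Ioi.1 hj).le
  simp [Nat.cast_sub this]

theorem continuous_geomProd {n : ℕ} (e : Fin n → ℕ) : Continuous (geomProd e) := by
  unfold geomProd
  fun_prop

/-- Both alternants vanish at equal coordinates when n ≥ 2. At the points x q ^ δ_j, however, each
is a Vandermonde product in the numbers q ^ e_i, and the common power of q - 1 cancels; continuity
then allows q = 1. -/
theorem eval_const_schurQuotient {n : ℕ} {e : Fin n → ℕ} (he : Antitone e) (x : ℂ) :
    x ^ (∑ i, staircase n i) * eval (fun i => ((staircase n i : ℕ) : ℂ)) (alternant (staircase n)) *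
        eval (fun _ => x) (schurQuotient e) =
      x ^ (∑ i, e i) * eval (fun i => ((e i : ℕ) : ℂ)) (alternant (staircase n)) := by
  have hδ := (strictAnti_staircase n).antitone
  set y : ℂ → Fin n → ℂ := fun q j => x * q ^ staircase n j with hy
  have hA : ∀ {e' : Fin n → ℕ}, Antitone e' → ∀ q : ℂ, eval (y q) (alternant e') =
      (∏ i : Fin n, ∏ _j ∈ Finset.Ioi i, (q - 1)) * (x ^ (∑ i, e' i) * geomProd e' q) := by
    intro e' he' q
    have h1 := eval_pow_alternant_staircase he' q
    rw [eval_alternant, ← Matrix.det_transpose] at h1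
    rw [mul_left_comm, ← h1, eval_alternant, ← Finset.prod_pow_eq_pow_sum, ← Matrix.det_mul_column]
    congr 1
    ext i j
    simp only [hy, Matrix.of_apply, Matrix.transpose_apply, mul_pow, ← pow_mul]
    rw [mul_comm (staircase n j)]
  have hfun : (fun q : ℂ => x ^ (∑ i, staircase n i) * geomProd (staircase n) q *
      eval (y q) (schurQuotient e)) = fun q : ℂ => x ^ (∑ i, e i) * geomProd e q := by
    refine Continuous.ext_on (dense_compl_singleton (1 : ℂ)) ?_ ?_ ?_
    · have h1 : Continuous y := by fun_prop
      have h2 := continuous_geomProd (staircase n)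
      have h3 := (MvPolynomial.continuous_eval (schurQuotient e)).comp h1
      exact (continuous_const.mul h2).mul h3
    · exact continuous_const.mul (continuous_geomProd e)
    · intro q hq
      have hq1 : q - 1 ≠ 0 := sub_ne_zero.2 hq
      have h1 := congrArg (eval (y q)) (alternant_staircase_mul_schurQuotient e)
      rw [map_mul, hA hδ, hA he, mul_assoc] at h1
      exact mul_left_cancel₀ (Finset.prod_ne_zero_iff.2 fun i _ =>
        Finset.prod_ne_zero_iff.2 fun j _ => hq1) h1
  have h := congrFun hfun 1
  simp only [geomProd_one hδ, geomProd_one he] at h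
  simpa [hy] using h

/-- The falling factorial kills the terms m < k and reduces m! to (m - k)!; shifting the summation
index moves k into the Bessel index. -/
theorem hasSum_pow_mul_descPochhammer_mul_besselCoeff (b x : ℂ) (k : ℕ) :
    HasSum (fun m : ℕ => x ^ m * (descPochhammer ℂ k).eval (m : ℂ) * besselCoeff b m)
      (x ^ k * besselSeries (b + k) x) := by
  have h1 : ∀ m : ℕ, x ^ (m + k) * (descPochhammer ℂ k).eval ((m + k : ℕ) : ℂ) *
      besselCoeff b (m + k) = x ^ k * (x ^ m * besselCoeff (b + k) m) := by
    intro m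
    rw [descPochhammer_eval_eq_descFactorial, besselCoeff, besselCoeff]
    have h2 : (((m + k)! : ℕ) : ℂ) = (m ! : ℂ) * ((m + k).descFactorial k : ℂ) := by
      have := Nat.factorial_mul_descFactorial (Nat.le_add_left k m)
      rw [Nat.add_sub_cancel] at this
      exact_mod_cast this.symm
    have h3 : ((m + k).descFactorial k : ℂ) ≠ 0 := by
      exact_mod_cast (Nat.descFactorial_eq_zero_iff_lt.not.2 (by omega))
    rw [h2, mul_inv, pow_add]
    have h4 : b + ((m + k : ℕ) : ℂ) + 1 = b + k + m + 1 := by push_cast; ring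
    rw [h4]
    field_simp
  have hs := (summable_pow_mul_besselCoeff' (b + k) x).hasSum.mul_left (x ^ k)
  simp only [← h1] at hs
  have h5 := (hasSum_nat_add_iff (f := fun m : ℕ => x ^ m * (descPochhammer ℂ k).eval (m : ℂ) *
    besselCoeff b m) k).1 hs
  have h6 : ∑ i ∈ Finset.range k, x ^ i * (descPochhammer ℂ k).eval (i : ℂ) * besselCoeff b i =
      0 := by
    refine Finset.sum_eq_zero fun i hi => ?_
    rw [descPochhammer_eval_eq_descFactorial,
      Nat.descFactorial_eq_zero_iff_lt.2 (Finset.mem_range.1 hi)]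
    simp
  rw [h6, add_zero] at h5
  exact h5

/-- Here the first determinant in Cauchy–Binet is x ^ |e| a_δ(e), written with falling factorials.
-/
theorem eval_alternant_mul_mvHyp_const {n : ℕ} {c : ℂ}
    (hc : ∀ i : ℕ, i < n → ∀ m : ℕ, c - (i : ℂ) ≠ -(m : ℂ)) {x : ℂ} (hx : x ≠ 0) :
    eval (fun i => ((staircase n i : ℕ) : ℂ)) (alternant (staircase n)) *
        mvHyp 1 [] [c] (fun _ : Fin n => x) = gammaProd n c *
      Matrix.det (Matrix.of fun i j : Fin n =>
        besselSeries (c - n - staircase n i + staircase n j) x) := by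
  by_cases hG : gammaProd n c = 0
  · simp [mvHyp, mvHypTerm_zero_one hc, hG]
  set K : ℂ := x ^ (∑ i, staircase n i) *
    eval (fun i => ((staircase n i : ℕ) : ℂ)) (alternant (staircase n))
  have hterm : ∀ l : IntPartition n, gammaProd n c *
      (Matrix.det (Matrix.of fun i j => x ^ ((l.1 + staircase n) i) *
          (descPochhammer ℂ (staircase n j)).eval (((l.1 + staircase n) i : ℕ) : ℂ)) *
        Matrix.det (Matrix.of fun i j => besselCoeff (c - n - staircase n i)
          ((l.1 + staircase n) j))) =
      K * mvHypTerm 1 [] [c] (fun _ => x) l := by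
    intro l
    have h1 := eval_const_schurQuotient (strictAnti_add_staircase l).antitone x
    rw [mvHypTerm_zero_one hc, eval_alternant_mul_prod_besselCoeff, Matrix.det_mul_column
      (fun i => x ^ ((l.1 + staircase n) i)) (fun i j =>
        (descPochhammer ℂ (staircase n j)).eval (((l.1 + staircase n) i : ℕ) : ℂ)),
      Finset.prod_pow_eq_pow_sum]
    have h2 := eval_alternant_staircase_eq_det (fun k => descPochhammer ℂ k)
      (fun k => descPochhammer_natDegree ℂ k) (fun k => monic_descPochhammer ℂ k)
      (fun i => (((l.1 + staircase n) i : ℕ) : ℂ))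
    rw [← Matrix.det_transpose] at h2
    have h3 : Matrix.det (fun i j =>
        (descPochhammer ℂ (staircase n j)).eval (((l.1 + staircase n) i : ℕ) : ℂ)) =
        eval (fun i => (((l.1 + staircase n) i : ℕ) : ℂ)) (alternant (staircase n)) := h2.symm
    rw [h3, ← h1]
    ring
  have hs := (summable_mvHypTerm hc (fun _ => x)).mul_left K
  simp only [← hterm] at hs
  rw [summable_mul_left_iff hG] at hs
  have hsum := fun i j : Fin n =>
    hasSum_pow_mul_descPochhammer_mul_besselCoeff (c - n - staircase n i) x (staircase n j)
  have h := tsum_det_mul_det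
    (fun j m => x ^ m * (descPochhammer ℂ (staircase n j)).eval (m : ℂ))
    (fun i m => besselCoeff (c - n - staircase n i) m) (fun i j => (hsum i j).summable) hs
  have hK : K * mvHyp 1 [] [c] (fun _ : Fin n => x) = gammaProd n c *
      Matrix.det (Matrix.of fun i j : Fin n => x ^ staircase n j *
        besselSeries (c - n - staircase n i + staircase n j) x) := by
    rw [mvHyp, ← tsum_mul_left]
    simp only [← hterm]
    rw [tsum_mul_left, h]
    simp only [(hsum _ _).tsum_eq]
  rw [Matrix.det_mul_row (fun j => x ^ staircase n j) (fun i j : Fin n =>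
    besselSeries (c - n - staircase n i + staircase n j) x), Finset.prod_pow_eq_pow_sum] at hK
  apply mul_left_cancel₀ (pow_ne_zero (∑ i, staircase n i) hx)
  rw [← mul_assoc, hK, mul_left_comm]
  rfl

/-! ### Signs, constants and the final formulas -/

/-- The number n(n - 1)/2 of pairs has the parity of ⌊n/2⌋. -/
theorem prod_Ioi_neg_one (n : ℕ) :
    ∏ i : Fin n, ∏ _j ∈ Finset.Ioi i, (-1 : ℂ) = (-1) ^ (n / 2) := by
  induction n with
  | zero => simp
  | succ n ih =>
    rw [Fin.prod_univ_succ]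
    simp only [Finset.prod_const, Fin.card_Ioi] at ih ⊢
    have h1 : ∀ i : Fin n, n + 1 - 1 - (i.succ : ℕ) = n - 1 - (i : ℕ) := fun i => by
      rw [Fin.val_succ]; omega
    simp only [h1]
    rw [ih, ← pow_add]
    simp only [Fin.val_zero]
    rcases Nat.even_or_odd' n with ⟨k, rfl | rfl⟩
    · rw [show (2 * k + 1) / 2 = k by omega, show 2 * k / 2 = k by omega,
        show 2 * k + 1 - 1 - 0 + k = 2 * k + k by omega, pow_add, pow_mul]
      simp
    · rw [show (2 * k + 1 + 1) / 2 = k + 1 by omega, show (2 * k + 1) / 2 = k by omega,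
        show 2 * k + 1 + 1 - 1 - 0 + k = 2 * k + (k + 1) by omega, pow_add, pow_mul]
      simp

theorem vandermondeProd_eq {n : ℕ} (x : Fin n → ℂ) :
    eval x (alternant (staircase n)) = (-1) ^ (n / 2) * vandermondeProd x := by
  rw [eval_alternant_staircase, vandermondeProd, ← prod_Ioi_neg_one, ← Finset.prod_mul_distrib]
  refine Finset.prod_congr rfl fun i _ => ?_
  rw [← Finset.prod_mul_distrib]
  exact Finset.prod_congr rfl fun j _ => by ring

theorem eval_staircase_alternant_staircase (n : ℕ) :
    eval (fun i => ((staircase n i : ℕ) : ℂ)) (alternant (staircase n)) =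
      ∏ j ∈ Finset.Icc 1 (n - 1), (j ! : ℂ) := by
  have h1 : eval (fun i => ((staircase n i : ℕ) : ℂ)) (alternant (staircase n)) =
      ∏ i : Fin n, ∏ j ∈ Finset.Ioi i, (((j : ℕ) : ℂ) - ((i : ℕ) : ℂ)) := by
    rw [eval_alternant_staircase]
    refine Finset.prod_congr rfl fun i _ => Finset.prod_congr rfl fun j _ => ?_
    rw [staircase_cast, staircase_cast]
    ring
  rw [h1, ← Matrix.det_vandermonde]
  cases n with
  | zero => simp
  | succ n =>
    rw [Matrix.det_vandermonde_id_eq_superFactorial, ← Nat.prod_Icc_factorial]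
    push_cast
    rfl

theorem mainTheorem9 (n : ℕ) (c : ℂ)
    (hc : ∀ i : ℕ, i < n → ∀ m : ℕ, c - (i : ℂ) ≠ -(m : ℂ)) :
    (∀ x : Fin n → ℂ, Summable (fun l : IntPartition n => mvHypTerm 1 [] [c] x l)) ∧
    Continuous (fun x : Fin n → ℂ => mvHyp 1 [] [c] x) ∧
    (∀ x : Fin n → ℂ, Function.Injective x → (∀ i, x i ≠ 0) →
      mvHyp 1 [] [c] x =
        (-1) ^ (n / 2) *
          ((∏ i : Fin n, Complex.Gamma (c + 1 - (((i : ℕ) : ℂ) + 1)) *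
              x i ^ ((n : ℂ) - c / 2)) / vandermondeProd x) *
          Matrix.det (Matrix.of fun i j : Fin n =>
            x j ^ (-(((i : ℕ) : ℂ) + 1) / 2) *
              besselI (c + (((i : ℕ) : ℂ) + 1) - 2 * (n : ℂ)) (2 * x j ^ (1 / 2 : ℂ)))) ∧
    (∀ x : ℂ, x ≠ 0 →
      mvHyp 1 [] [c] (fun _ : Fin n => x) =
        x ^ ((n : ℂ) * ((n : ℂ) - c) / 2) *
          ((∏ i : Fin n, Complex.Gamma (c + 1 - (((i : ℕ) : ℂ) + 1))) /
            ∏ j ∈ Finset.Icc 1 (n - 1), (j ! : ℂ)) *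
          Matrix.det (Matrix.of fun i j : Fin n =>
            besselI (c - (n : ℂ) + ((j : ℕ) : ℂ) - ((i : ℕ) : ℂ)) (2 * x ^ (1 / 2 : ℂ)))) := by
  refine ⟨summable_mvHypTerm hc, continuous_mvHyp hc, fun x hinj hx0 => ?_, fun x hx => ?_⟩
  · have h := eval_alternant_mul_mvHyp hc x
    have hV := eval_alternant_staircase_ne_zero_iff.2 hinj
    -- The half powers combine to x_j ^ (c/2 - n) in every row, so they leave the determinant as
    -- column factors.
    have hdet : Matrix.det (Matrix.of fun i j : Fin n =>
        x j ^ (-(((i : ℕ) : ℂ) + 1) / 2) *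
          besselI (c + (((i : ℕ) : ℂ) + 1) - 2 * (n : ℂ)) (2 * x j ^ (1 / 2 : ℂ))) =
        (∏ j, (x j ^ ((n : ℂ) - c / 2))⁻¹) *
          Matrix.det (Matrix.of fun i j : Fin n =>
            besselSeries (c - n - staircase n i) (x j)) := by
      rw [← Matrix.det_mul_row]
      congr 1
      ext i j
      simp only [Matrix.of_apply]
      rw [besselI_two_mul_sqrt, ← mul_assoc, ← Complex.cpow_add _ _ (hx0 j), ← Complex.cpow_neg,
        staircase_cast]
      congr 2 <;> ring
    have hne : ∏ j, x j ^ ((n : ℂ) - c / 2) ≠ 0 :=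
      Finset.prod_ne_zero_iff.2 fun j _ => by simp [Complex.cpow_eq_zero_iff, hx0 j]
    have hsign : ((-1 : ℂ) ^ (n / 2)) * (-1) ^ (n / 2) = 1 := by
      rw [← mul_pow]; simp
    rw [vandermondeProd_eq] at h hV
    have hV' := right_ne_zero_of_mul hV
    rw [hdet, Finset.prod_mul_distrib, Finset.prod_inv_distrib]
    rw [gammaProd] at h
    generalize ∏ j, x j ^ ((n : ℂ) - c / 2) = P at hne ⊢
    field_simp
    linear_combination (-1) ^ (n / 2) * h - vandermondeProd x * mvHyp 1 [] [c] x * hsign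
  · have h := eval_alternant_mul_mvHyp_const hc hx
    rw [eval_staircase_alternant_staircase] at h
    have hdet : Matrix.det (Matrix.of fun i j : Fin n =>
        besselI (c - (n : ℂ) + ((j : ℕ) : ℂ) - ((i : ℕ) : ℂ)) (2 * x ^ (1 / 2 : ℂ))) =
        (∏ _j : Fin n, x ^ ((c - n) / 2)) * Matrix.det (Matrix.of fun i j : Fin n =>
          besselSeries (c - n - staircase n i + staircase n j) x) := by
      -- The index c - n + j - i is the transpose of the one in the series determinant; the factors
      -- x ^ (-i/2) of the rows and x ^ (j/2) of the columns cancel in the product.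
      have hM : (Matrix.of fun i j : Fin n =>
          besselI (c - (n : ℂ) + ((j : ℕ) : ℂ) - ((i : ℕ) : ℂ)) (2 * x ^ (1 / 2 : ℂ))) =
          Matrix.of fun i j : Fin n => x ^ ((c - n - ((i : ℕ) : ℂ)) / 2) *
            Matrix.of (fun i j : Fin n => x ^ (((j : ℕ) : ℂ) / 2) *
              (Matrix.of fun i j : Fin n =>
                besselSeries (c - n - staircase n i + staircase n j) x).transpose i j) i j := by
        ext i j
        simp only [Matrix.of_apply, Matrix.transpose_apply]
        rw [besselI_two_mul_sqrt, ← mul_assoc, ← Complex.cpow_add _ _ hx, staircase_cast, staircase_cast]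
        congr 2 <;> ring
      rw [hM, Matrix.det_mul_column, Matrix.det_mul_row, Matrix.det_transpose, ← mul_assoc,
        ← Finset.prod_mul_distrib]
      congr 1
      refine Finset.prod_congr rfl fun i _ => ?_
      rw [← Complex.cpow_add _ _ hx]
      congr 1
      ring
    -- The outer exponent is a natural number, so no branch question arises.
    have hpow : x ^ ((n : ℂ) * ((n : ℂ) - c) / 2) * ∏ _j : Fin n, x ^ ((c - n) / 2) = 1 := by
      rw [Finset.prod_const, Finset.card_univ, Fintype.card_fin, ← Complex.cpow_nat_mul,
        ← Complex.cpow_add _ _ hx]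
      convert! Complex.cpow_zero x using 2
      ring
    have hfac : ∏ j ∈ Finset.Icc 1 (n - 1), (j ! : ℂ) ≠ 0 :=
      Finset.prod_ne_zero_iff.2 fun j _ => by exact_mod_cast Nat.factorial_ne_zero j
    rw [hdet]
    rw [gammaProd] at h
    field_simp
    rw [mul_comm (mvHyp 1 [] [c] fun _ : Fin n => x), h]
    linear_combination (-(∏ i : Fin n, Complex.Gamma (c + 1 - (((i : ℕ) : ℂ) + 1))) *
      Matrix.det (Matrix.of fun i j : Fin n =>
          besselSeries (c - n - staircase n i + staircase n j) x)) * hpow
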